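/- Let $S\in\mathbb R$, $\sigma>0$, $\tau>0$. On a probability space let $(p^\star_t)_{t\ge0}$ be a Brownian motion with volatility $\sigma$ and arbitrary initial value (i.e. $(p^\star_t-p^\star_0)/\sigma$ is a standard Brownian motion), let $X_t$, $t\ge 0$, be Bernoulli variables with $\mathbb P(X_t=1)=\mathbb P(X_t=0)=\tfrac12$, and put $\eta_t=S(X_t-\tfrac12)$. Assume that the variables $(\eta_t)_{t\ge0}$ are mutually independent and that the processes $p^\star$ and $\eta$ are independent of each other. The log-price is $p_t=p^\star_t+\eta_t$, observed at the times $0,\tau,\dots,(n-1)\tau$. For an integer $L\ge1$ put $k_1(n,L)=n-L$, $k_2(n,L)=\lfloor (n-1)/L\rfloor$, $k_3(n,L)=\lfloor n/(L+1)\rfloor$ and $$\widehat V_1(n,L)=\frac1{k_1(n,L)}\sum_{i=0}^{k_1(n,L)-1}\bigl(p_{(i+L)\tau}-p_{i\tau}\bigr)^2,\qquad \widehat V_2(n,L)=\frac1{k_2(n,L)}\sum_{i=0}^{k_2(n,L)-1}\bigl(p_{(i+1)L\tau}-p_{iL\tau}\bigr)^2,$$ $$\widehat V_3(n,L)=\frac1{k_3(n,L)}\sum_{i=0}^{k_3(n,L)-1}\bigl(p_{(i+(i+1)L)\tau}-p_{(i+iL)\tau}\bigr)^2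 .$$ For $v\in\{1,2,3\}$ and fixed integers $L,L'\ge1$ with $L\ne L'$, consider the estimator $$\widehat{S^2_{1,v}}(n,L,L')=\frac{2}{L'-L}\bigl(L'\,\widehat V_v(n,L)-L\,\widehat V_v(n,L')\bigr).$$ Let $(\zeta_1(L),\zeta_2(L),\zeta_3(L))=(1,L,L+1)$ and $$\sigma_{1,1}^2(L)=\tfrac23\sigma^4L(1+2L^2)\tau^2+2\sigma^2L\tau S^2+\tfrac{S^4}4,\qquad \sigma_{1,2}^2(L)=\sigma_{1,3}^2(L)=2\sigma^4L^2\tau^2+2\sigma^2L\tau S^2+\tfrac{S^4}4 ,$$ with $\sigma_{1,v}(L)\ge 0$ the square root of $\sigma_{1,v}^2(L)$. Then: 1. $\widehat{S^2_{1,v}}(n,L,L')$ is an unbiased estimator of $S^2$: for every $n>\max(L,L')$ it is integrable with expectation $S^2$. 2. It is consistent: $\widehat{S^2_{1,v}}(n,L,L')\to S^2$ in probability as $n\to\infty$. When $v=3$, the convergence holds almost surely. 3. The limit $r_{1,v}(L,L')=\lim_{n\to\infty}\operatorname{corr}\bigl(\widehat V_v(n,L),\widehat V_v(n,L')\bigr)$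 exists, and $$\sqrt n\,\bigl(\widehat{S^2_{1,v}}(n,L,L')-S^2\bigr)\overset{d}{\longrightarrow}\mathcal N\bigl(0,\gamma_{1,v}(L,L')\bigr)\quad(n\to\infty),$$ where the variance $$\gamma_{1,v}(L,L')=\frac4{(L'-L)^2}\Bigl(L'^2\zeta_v(L)\sigma^2_{1,v}(L)+L^2\zeta_v(L')\sigma^2_{1,v}(L')-2LL'\sqrt{\zeta_v(L)\zeta_v(L')}\,\sigma_{1,v}(L)\sigma_{1,v}(L')\,r_{1,v}(L,L')\Bigr)$$ is non-negative ($\mathcal N(0,0)$ denoting the Dirac mass at $0$). 4. If $L'=m(L+1)-1$ for an integer $m\ge2$, then $\gamma_{1,3}(L,L')=\Gamma(L,L')$, where, with $V(u)=\operatorname{Var}(p_u-p_0)$ and $K(u,\delta)=\mathbb E\bigl[(p_u-p_0)^2(p_{2u-\delta}-p_{u-\delta})^2\bigr]$, $$\begin{aligned}\Gamma(L,L')=\frac{4(L'+1)}{(L'-L)^2}\Bigl\{&L'\Bigl(\frac{L'(L+1)}{L'+1}-2L\Bigr)\bigl(K(L\tau,L\tau)-V(L\tau)^2\bigr)+L^2\bigl(K(L'\tau,L'\tau)-V(L'\tau)^2\bigr)\\&-2L'L\Bigl(-2\frac{L'-L}{L'+1}S^2V(L\tau)+\frac{3L'-4L-1}{L'+1}\frac{S^4}4\Bigr)\Bigr\}.\end{aligned}$$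 -/

import Mathlib

open MeasureTheory ProbabilityTheory Filter Topology
open scoped NNReal

namespace BidAskSpread

noncomputable section

/-- The process `W` is a real Brownian motion with volatility `σ` and an arbitrary (possibly random)
initial value: `(W t - W 0) / σ` is a standard Brownian motion. -/
structure IsBrownianWithVolatility {Ω : Type*} [MeasurableSpace Ω]
    (W : ℝ≥0 → Ω → ℝ) (σ : ℝ) (μ : Measure Ω) : Prop where
  aemeasurable_zero : AEMeasurable (W 0) μ
  isBrownianReal : IsBrownianReal (fun t ω => (W t ω - W 0 ω) / σ) μ

/-- The Bernoulli distribution `B(1/2)` on `{0, 1} ⊆ ℝ`. -/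
def bernoulliHalf : Measure ℝ :=
  bernoulliMeasure (1 : ℝ) 0 ⟨1 / 2, by norm_num, by norm_num⟩

/-- The microstructure noise `η_t = S (X_t - 1/2)`. -/
def noise {Ω : Type*} (S : ℝ) (X : ℝ≥0 → Ω → ℝ) (t : ℝ≥0) (ω : Ω) : ℝ :=
  S * (X t ω - 1 / 2)

/-- The observed log-price `p_t = p⋆_t + η_t`. -/
def logPrice {Ω : Type*} (S : ℝ) (pStar X : ℝ≥0 → Ω → ℝ) (t : ℝ≥0) (ω : Ω) : ℝ :=
  pStar t ω + noise S X t ω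

/-- The assumptions of the zero-autocorrelation market model. -/
structure MarketModel {Ω : Type*} [MeasurableSpace Ω] (μ : Measure Ω)
    (pStar X : ℝ≥0 → Ω → ℝ) (σ S : ℝ) : Prop where
  /-- the logarithmic mid price is a Brownian motion with volatility `σ` -/
  brownian : IsBrownianWithVolatility pStar σ μ
  /-- the trade directions are Bernoulli variables of parameter `1/2` -/
  direction_law : ∀ t, HasLaw (X t) bernoulliHalf μ
  /-- the noise variables at distinct times are (mutually) independent -/
  noise_indep : iIndepFun (noise S X) μ
  /-- the processes `p⋆` and `η` are independent of each other -/
  mid_indep_noise : IndepFun (fun ω t => pStar t ω) (fun ω t => noise S X t ω) μ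

/-- The three ways of selecting price increments: overlapping (`v = 1`), non-overlapping (`v = 2`)
and strictly disjoint (`v = 3`). -/
inductive Scheme where
  | overlapping
  | nonOverlapping
  | disjoint

/-- The number `k_v(n, L)` of increments. -/
def Scheme.count : Scheme → ℕ → ℕ → ℕ
  | .overlapping, n, L => n - L
  | .nonOverlapping, n, L => (n - 1) / L
  | .disjoint, n, L => n / (L + 1)

/-- The `i`-th increment is `p_{(a + L) τ} - p_{a τ}`, where `a = v.start L i`. -/
def Scheme.start : Scheme → ℕ → ℕ → ℕ
  | .overlapping, _, i => i
  | .nonOverlapping, L, i => i * L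
  | .disjoint, L, i => i + i * L

/-- The factor `ζ_v(L)`. -/
def Scheme.zeta : Scheme → ℕ → ℝ
  | .overlapping, _ => 1
  | .nonOverlapping, L => L
  | .disjoint, L => L + 1

/-- The empirical variance `V̂_v(n, L)`, with zero mean, of the increments of duration `L τ` of the
process `p`, observed at the times `0, τ, …, (n - 1) τ`. -/
def empVar {Ω : Type*} (p : ℝ≥0 → Ω → ℝ) (τ : ℝ≥0) (v : Scheme) (n L : ℕ) (ω : Ω) : ℝ :=
  1 / (v.count n L : ℝ) * ∑ i ∈ Finset.range (v.count n L),
    (p (((v.start L i + L : ℕ) : ℝ≥0) * τ) ω - p (((v.start L i : ℕ) : ℝ≥0) * τ) ω) ^ 2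

/-- The estimator `2 (L' V̂_v(n, L) - L V̂_v(n, L')) / (L' - L)` of the squared spread. -/
def spreadEstimator {Ω : Type*} (p : ℝ≥0 → Ω → ℝ) (τ : ℝ≥0) (v : Scheme) (L L' n : ℕ) (ω : Ω) : ℝ :=
  2 / ((L' : ℝ) - L) * (L' * empVar p τ v n L ω - L * empVar p τ v n L' ω)

/-- The variance `V(u)` of a price increment of duration `u`. -/
def incrementVar {Ω : Type*} [MeasurableSpace Ω] (p : ℝ≥0 → Ω → ℝ) (μ : Measure Ω) (u : ℝ≥0) : ℝ :=
  Var[fun ω => p u ω - p 0 ω; μ]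

/-- The mixed moment `K(u, δ) = E[(p_u - p_0)² (p_{2u-δ} - p_{u-δ})²]`, for `δ ≤ u`. -/
def incrementMoment {Ω : Type*} [MeasurableSpace Ω] (p : ℝ≥0 → Ω → ℝ) (μ : Measure Ω)
    (u : ℝ≥0) (δ : ℝ) : ℝ :=
  ∫ ω, (p u ω - p 0 ω) ^ 2 *
    (p (Real.toNNReal (2 * u - δ)) ω - p (Real.toNNReal (u - δ)) ω) ^ 2 ∂μ

/-- The correlation coefficient of two real random variables. -/
def corr {Ω : Type*} [MeasurableSpace Ω] (μ : Measure Ω) (Y Z : Ω → ℝ) : ℝ :=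
  cov[Y, Z; μ] / (√(Var[Y; μ]) * √(Var[Z; μ]))

/-- The constant `σ²_{1,v}(L)`. -/
def sigmaSq (σ S : ℝ) (τ : ℝ≥0) (v : Scheme) (L : ℕ) : ℝ :=
  match v with
  | .overlapping =>
      2 / 3 * σ ^ 4 * L * (1 + 2 * (L : ℝ) ^ 2) * (τ : ℝ) ^ 2 + 2 * σ ^ 2 * L * τ * S ^ 2 + S ^ 4 / 4
  | .nonOverlapping | .disjoint =>
      2 * σ ^ 4 * (L : ℝ) ^ 2 * (τ : ℝ) ^ 2 + 2 * σ ^ 2 * L * τ * S ^ 2 + S ^ 4 / 4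

/-- The asymptotic variance `γ_{1,v}(L, L')`, where `r` stands for the limit of the correlation
coefficients of `V̂_v(n, L)` and `V̂_v(n, L')`. -/
def asympVar (σ S : ℝ) (τ : ℝ≥0) (v : Scheme) (L L' : ℕ) (r : ℝ) : ℝ :=
  4 / ((L' : ℝ) - L) ^ 2 *
    ((L' : ℝ) ^ 2 * v.zeta L * sigmaSq σ S τ v L + (L : ℝ) ^ 2 * v.zeta L' * sigmaSq σ S τ v L'
      - 2 * L * L' * √(v.zeta L * v.zeta L') * √(sigmaSq σ S τ v L) * √(sigmaSq σ S τ v L') * r)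

/-- The explicit variance `Γ(L, L')`. -/
def explicitVar {Ω : Type*} [MeasurableSpace Ω] (p : ℝ≥0 → Ω → ℝ) (μ : Measure Ω) (S : ℝ) (τ : ℝ≥0)
    (L L' : ℕ) : ℝ :=
  let V : ℕ → ℝ := fun l => incrementVar p μ (l * τ)
  let K : ℕ → ℝ := fun l => incrementMoment p μ (l * τ) (l * τ)
  4 * ((L' : ℝ) + 1) / ((L' : ℝ) - L) ^ 2 *
    (L' * (L' * ((L : ℝ) + 1) / (L' + 1) - 2 * L) * (K L - V L ^ 2)
      + (L : ℝ) ^ 2 * (K L' - V L' ^ 2)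
      - 2 * L' * L * (-2 * (((L' : ℝ) - L) / (L' + 1)) * S ^ 2 * V L
          + (3 * (L' : ℝ) - 4 * L - 1) / (L' + 1) * (S ^ 4 / 4)))

end

end BidAskSpread

/-! On the observation grid the price increments are functions of i.i.d. innovations, namely the
pairs of a Gaussian mid-price increment and a noise variable. The squared increments selected by a
scheme, centred and padded with `0` at the instants where none starts, form a periodic functional of
finite range of these innovations. Their covariance kernel is therefore banded and periodic, so the
Cesàro means of its double sums converge; this gives the limits of `n` times the variances and
covariances of the empirical variances, hence that of their correlation.

For the central limit theorem, cut the time axis into long blocks of whole periods separated by gaps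
of the range of the functional: the block sums are i.i.d., what they omit is small in `L²` after
normalization, and the limit law survives letting the block length tend to infinity in the
characteristic functions. The asymptotic variance is the limit of `n` times the variance of the
estimator, whence its non-negativity, and the closed form of `γ_{1,3}` comes from summing the
kernel, computed with Isserlis' formula, over one period. -/

namespace BidAskSpread

section Independence

variable {Ω : Type*} [MeasurableSpace Ω] {μ : Measure Ω}

lemma iIndepFun_prodMk_of_measurable {ι : Type*} {E F : ι → Type*} [∀ i, MeasurableSpace (E i)]
    [∀ i, MeasurableSpace (F i)] {X : ∀ i, Ω → E i} {Y : ∀ i, Ω → F i}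
    (mX : ∀ i, Measurable (X i)) (mY : ∀ i, Measurable (Y i))
    (hX : iIndepFun X μ) (hY : iIndepFun Y μ)
    (hXY : IndepFun (fun ω i => X i ω) (fun ω i => Y i ω) μ) :
    iIndepFun (fun i ω => (X i ω, Y i ω)) μ := by
  have := hX.isProbabilityMeasure
  let boxes : ∀ i, Set (Set (E i × F i)) := fun i =>
    Set.image2 (· ×ˢ ·) {s | MeasurableSet s} {t | MeasurableSet t}
  refine iIndepSets.iIndep (fun i => ((mX i).prodMk (mY i)).comap_le)
    (fun i => Set.preimage (fun ω => (X i ω, Y i ω)) '' boxes i)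
    (fun i => isPiSystem_prod.comap _)
    (fun i => by rw [← MeasurableSpace.comap_generateFrom, generateFrom_prod])
    ((iIndepSets_iff _ _).2 fun s f hf => ?_)
  have hbox : ∀ i ∈ s, ∃ A B, MeasurableSet A ∧ MeasurableSet B ∧
      f i = X i ⁻¹' A ∩ Y i ⁻¹' B := by
    intro i hi
    obtain ⟨_, ⟨A, hA, B, hB, rfl⟩, hfi⟩ := hf i hi
    exact ⟨A, B, hA, hB, hfi.symm⟩
  choose! A B hA hB hAB using hbox
  have hpair : ∀ i ∈ s, μ (f i) = μ (X i ⁻¹' A i) * μ (Y i ⁻¹' B i) := fun i hi => by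
    rw [hAB i hi]
    exact indepFun_iff_measure_inter_preimage_eq_mul.1
      (hXY.comp (measurable_pi_apply i) (measurable_pi_apply i)) _ _ (hA i hi) (hB i hi)
  have hfactor := indepFun_iff_measure_inter_preimage_eq_mul.1 hXY
    ((s : Set ι).pi A) ((s : Set ι).pi B) (.pi s.countable_toSet hA) (.pi s.countable_toSet hB)
  simp only [Set.pi_def, Set.preimage_iInter, Finset.mem_coe] at hfactor
  calc μ (⋂ i ∈ s, f i) = μ ((⋂ i ∈ s, X i ⁻¹' A i) ∩ ⋂ i ∈ s, Y i ⁻¹' B i) := by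
        simp_rw [← Set.iInter_inter_distrib]
        exact congrArg μ (Set.iInter₂_congr hAB)
    _ = (∏ i ∈ s, μ (X i ⁻¹' A i)) * ∏ i ∈ s, μ (Y i ⁻¹' B i) := by
        rw [← hX.measure_inter_preimage_eq_mul s hA, ← hY.measure_inter_preimage_eq_mul s hB]
        exact hfactor
    _ = ∏ i ∈ s, μ (f i) := by
        rw [← Finset.prod_mul_distrib]
        exact Finset.prod_congr rfl fun i hi => (hpair i hi).symm

lemma iIndepFun_prodMk {ι : Type*} [Countable ι] {E F : ι → Type*} [∀ i, MeasurableSpace (E i)]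
    [∀ i, MeasurableSpace (F i)] {X : ∀ i, Ω → E i} {Y : ∀ i, Ω → F i}
    (mX : ∀ i, AEMeasurable (X i) μ) (mY : ∀ i, AEMeasurable (Y i) μ)
    (hX : iIndepFun X μ) (hY : iIndepFun Y μ)
    (hXY : IndepFun (fun ω i => X i ω) (fun ω i => Y i ω) μ) :
    iIndepFun (fun i ω => (X i ω, Y i ω)) μ := by
  have eX : ∀ i, X i =ᵐ[μ] (mX i).mk := fun i => (mX i).ae_eq_mk
  have eY : ∀ i, Y i =ᵐ[μ] (mY i).mk := fun i => (mY i).ae_eq_mk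
  refine (iIndepFun_prodMk_of_measurable (fun i => (mX i).measurable_mk)
    (fun i => (mY i).measurable_mk) (hX.congr eX) (hY.congr eY)
    (hXY.process_congr eX eY)).congr fun i => ?_
  exact ((eX i).prodMk (eY i)).symm

lemma iIndepFun_curry {ι κ E : Type*} [Countable ι] [Countable κ] [MeasurableSpace E]
    {X : ι → κ → Ω → E} (hX : ∀ i j, AEMeasurable (X i j) μ)
    (h : iIndepFun (fun (p : ι × κ) => X p.1 p.2) μ) :
    iIndepFun (fun i ω j => X i j ω) μ := by
  have := h.isProbabilityMeasure
  have hprob : ∀ i j, IsProbabilityMeasure (μ.map (X i j)) :=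
    fun i j => Measure.isProbabilityMeasure_map (hX i j)
  have hpair : AEMeasurable (fun ω (p : ι × κ) => X p.1 p.2 ω) μ :=
    aemeasurable_pi_iff.2 fun p => hX p.1 p.2
  have hlaw : ∀ i, μ.map (fun ω j => X i j ω) = Measure.infinitePi fun j => μ.map (X i j) :=
    fun i => (h.precomp (Prod.mk_right_injective i)).map_fun_eq_infinitePi_map₀' (hX i)
  rw [iIndepFun_iff_map_fun_eq_infinitePi_map₀' fun i => aemeasurable_pi_iff.2 (hX i)]
  simp_rw [hlaw]
  rw [← Measure.infinitePi_map_curry (fun i j => μ.map (X i j)),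
    ← h.map_fun_eq_infinitePi_map₀ hpair,
    AEMeasurable.map_map_of_aemeasurable (MeasurableEquiv.measurable _).aemeasurable hpair]
  rfl

lemma iIndepFun_block {E F : Type*} [MeasurableSpace E] [MeasurableSpace F] {Z : ℕ → Ω → E}
    (mZ : ∀ j, AEMeasurable (Z j) μ) (hZ : iIndepFun Z μ) {P : ℕ} (hP : 0 < P)
    {G : (ℕ → E) → F} (hG : Measurable G) (hGP : ∀ z z', (∀ r < P, z r = z' r) → G z = G z') :
    iIndepFun (fun q ω => G (fun r => Z (q * P + r) ω)) μ := by
  have : NeZero P := ⟨hP.ne'⟩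
  have hblocks := iIndepFun_curry (X := fun (q : ℕ) (r : Fin P) => Z (q * P + r))
    (fun q r => mZ _) (hZ.precomp (Nat.divModEquiv P).symm.injective)
  let extend : (Fin P → E) → ℕ → E := fun z r => z (Fin.ofNat P r)
  have hextend : Measurable extend := measurable_pi_lambda _ fun r => measurable_pi_apply _
  refine (hblocks.comp (fun _ z => G (extend z)) fun _ => hG.comp hextend).congr fun q => ?_
  refine ae_of_all _ fun ω => hGP _ _ fun r hr => ?_
  simp [extend, Nat.mod_eq_of_lt hr]

lemma identDistrib_shift {E F : Type*} [MeasurableSpace E] [MeasurableSpace F] {Z : ℕ → Ω → E}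
    (hZ : iIndepFun Z μ) (hZd : ∀ j, IdentDistrib (Z j) (Z 0) μ μ)
    {G : (ℕ → E) → F} (hG : Measurable G) (m : ℕ) :
    IdentDistrib (fun ω => G (fun r => Z (m + r) ω)) (fun ω => G (fun r => Z r ω)) μ μ := by
  have mZ : ∀ j, AEMeasurable (Z j) μ := fun j => (hZd j).aemeasurable_fst
  have hpath : IdentDistrib (fun ω r => Z (m + r) ω) (fun ω r => Z r ω) μ μ := by
    refine ⟨aemeasurable_pi_iff.2 fun r => mZ _, aemeasurable_pi_iff.2 fun r => mZ _, ?_⟩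
    rw [(hZ.precomp (add_right_injective m)).map_fun_eq_infinitePi_map₀' (fun r => mZ _),
      hZ.map_fun_eq_infinitePi_map₀' mZ]
    simp_rw [(hZd _).map_eq]
  exact hpath.comp hG

end Independence

section Moments

lemma integral_pow_four_gaussianReal (v : ℝ≥0) :
    ∫ x, x ^ 4 ∂(gaussianReal 0 v) = 3 * (v : ℝ) ^ 2 := by
  have hderiv : ∀ p : Polynomial ℝ, deriv (fun t => p.eval t * Real.exp (v * t ^ 2 / 2)) =
      fun t => (p.derivative + .C (v : ℝ) * .X * p).eval t * Real.exp (v * t ^ 2 / 2) := by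
    intro p
    ext t
    have hsq : HasDerivAt (fun t : ℝ => (v : ℝ) * t ^ 2 / 2) (v * t) t :=
      (((hasDerivAt_pow 2 t).const_mul (v : ℝ)).div_const 2).congr_deriv (by push_cast; ring)
    refine ((p.hasDerivAt t).fun_mul hsq.exp).deriv.trans ?_
    simp only [Polynomial.eval_add, Polynomial.eval_mul, Polynomial.eval_C, Polynomial.eval_X]
    ring
  have hmgf : mgf id (gaussianReal 0 v) =
      fun t => (1 : Polynomial ℝ).eval t * Real.exp (v * t ^ 2 / 2) := by
    simp [mgf_id_gaussianReal]
  have hmoment := iteratedDeriv_mgf_zero (X := (id : ℝ → ℝ)) (μ := gaussianReal 0 v) (by simp) 4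
  simp only [iteratedDeriv_succ, iteratedDeriv_zero, hmgf, hderiv, Pi.pow_apply, id_eq] at hmoment
  rw [← hmoment]
  simp
  ring

variable {Ω : Type*} [MeasurableSpace Ω] {μ : Measure Ω} {B B' N N' : Ω → ℝ}

lemma integral_pow_four_of_hasGaussianLaw (hB : HasGaussianLaw B μ) (hB0 : μ[B] = 0) :
    ∫ ω, B ω ^ 4 ∂μ = 3 * Var[B; μ] ^ 2 := by
  rw [← integral_map (f := fun x => x ^ 4) hB.aemeasurable (by fun_prop), hB.map_eq_gaussianReal,
    hB0, integral_pow_four_gaussianReal, Real.coe_toNNReal _ (variance_nonneg _ _)]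

lemma covariance_congr_ae {X X' Y Y' : Ω → ℝ} (hX : X =ᵐ[μ] X') (hY : Y =ᵐ[μ] Y') :
    cov[X, Y; μ] = cov[X', Y'; μ] := by
  rw [covariance, covariance, integral_congr_ae hX, integral_congr_ae hY]
  refine integral_congr_ae ?_
  filter_upwards [hX, hY] with ω hω hω'
  rw [hω, hω']

lemma memLp_two_mul (hB : MemLp B 4 μ) (hN : MemLp N 4 μ) : MemLp (fun ω => B ω * N ω) 2 μ := by
  have : ENNReal.HolderTriple 4 4 2 := ⟨by
    rw [show (4 : ENNReal) = 2 * 2 by norm_num, ENNReal.mul_inv (by simp) (by simp), ← mul_two,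
      mul_assoc, ENNReal.inv_mul_cancel (by simp) (by simp), mul_one]⟩
  exact hN.mul' hB

lemma memLp_two_sq (hB : MemLp B 4 μ) : MemLp (fun ω => B ω ^ 2) 2 μ := by
  simpa only [pow_two] using memLp_two_mul hB hB

/-- **Isserlis' theorem** for the squares of two jointly Gaussian variables. -/
lemma covariance_sq_sq_of_hasGaussianLaw (h : HasGaussianLaw (fun ω => (B ω, B' ω)) μ)
    (hB0 : μ[B] = 0) (hB0' : μ[B'] = 0) :
    cov[fun ω => B ω ^ 2, fun ω => B' ω ^ 2; μ] = 2 * cov[B, B'; μ] ^ 2 := by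
  have := h.isProbabilityMeasure
  have mB : MemLp B 4 μ := h.fst.memLp (by simp)
  have mB' : MemLp B' 4 μ := h.snd.memLp (by simp)
  have hpow : ∀ {Y : Ω → ℝ}, HasGaussianLaw Y μ → Integrable (fun ω => Y ω ^ 4) μ := fun hY => by
    simpa only [← pow_mul] using (memLp_two_sq (hY.memLp (by simp))).integrable_sq
  have hadd := integral_pow_four_of_hasGaussianLaw h.fun_add
    (by rw [integral_add h.fst.integrable h.snd.integrable, hB0, hB0', add_zero])
  have hsub := integral_pow_four_of_hasGaussianLaw h.fun_sub
    (by rw [integral_sub h.fst.integrable h.snd.integrable, hB0, hB0', sub_zero])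
  rw [variance_fun_add h.fst.memLp_two h.snd.memLp_two] at hadd
  rw [variance_fun_sub h.fst.memLp_two h.snd.memLp_two] at hsub
  -- polarization reduces the mixed moment to fourth moments of Gaussian variables
  have hpolar : ∫ ω, B ω ^ 2 * B' ω ^ 2 ∂μ = 1 / 12 * ((∫ ω, (B ω + B' ω) ^ 4 ∂μ) +
      (∫ ω, (B ω - B' ω) ^ 4 ∂μ) - 2 * (∫ ω, B ω ^ 4 ∂μ) - 2 * ∫ ω, B' ω ^ 4 ∂μ) := by
    have hadd4 := hpow h.fun_add
    have hsub4 := hpow h.fun_sub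
    have hfst4 := hpow h.fst
    have hsnd4 := hpow h.snd
    rw [← integral_const_mul, ← integral_const_mul, ← integral_add hadd4 hsub4,
      ← integral_sub (by fun_prop) (by fun_prop), ← integral_sub (by fun_prop) (by fun_prop),
      ← integral_const_mul]
    exact integral_congr_ae (ae_of_all _ fun ω => by ring)
  rw [covariance_eq_sub (memLp_two_sq mB) (memLp_two_sq mB')]
  simp only [Pi.mul_apply]
  rw [hpolar, hadd, hsub, integral_pow_four_of_hasGaussianLaw h.fst hB0,
    integral_pow_four_of_hasGaussianLaw h.snd hB0',
    ← variance_of_integral_eq_zero h.fst.aemeasurable hB0,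
    ← variance_of_integral_eq_zero h.snd.aemeasurable hB0']
  ring

lemma integral_sq_sum_sub_integral [IsFiniteMeasure μ] {ι : Type*} {X : ι → Ω → ℝ} (I : Finset ι)
    (hX : ∀ i ∈ I, MemLp (X i) 2 μ) :
    ∫ ω, (∑ i ∈ I, (X i ω - ∫ ω', X i ω' ∂μ)) ^ 2 ∂μ = Var[fun ω => ∑ i ∈ I, X i ω; μ] := by
  rw [variance_eq_integral (memLp_finsetSum I hX).aestronglyMeasurable.aemeasurable,
    integral_finsetSum _ fun i hi => (hX i hi).integrable one_le_two]
  simp only [Finset.sum_sub_distrib]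

lemma covariance_mul_eq_zero_of_indepFun [IsProbabilityMeasure μ] (hB : MemLp B 2 μ)
    (hB' : AEStronglyMeasurable B' μ) (hN : AEStronglyMeasurable N μ)
    (hB'N : MemLp (fun ω => B' ω * N ω) 2 μ)
    (hind : IndepFun (fun ω => (B ω, B' ω)) N μ) (hN0 : μ[N] = 0) :
    cov[B, fun ω => B' ω * N ω; μ] = 0 := by
  have hBB'N : IndepFun (fun ω => B ω * B' ω) N μ := hind.comp measurable_mul measurable_id
  have hB'N_indep : IndepFun B' N μ := hind.comp measurable_snd measurable_id
  rw [covariance_eq_sub hB hB'N]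
  simp only [Pi.mul_apply, ← mul_assoc]
  rw [hBB'N.integral_fun_mul_eq_mul_integral (hB.1.mul hB') hN,
    hB'N_indep.integral_fun_mul_eq_mul_integral hB' hN, hN0]
  simp

lemma covariance_mul_mul_of_indepFun [IsProbabilityMeasure μ]
    (hB : MemLp B 4 μ) (hB' : MemLp B' 4 μ) (hN : MemLp N 4 μ) (hN' : MemLp N' 4 μ)
    (hind : IndepFun (fun ω => (B ω, B' ω)) (fun ω => (N ω, N' ω)) μ)
    (hN0 : μ[N] = 0) :
    cov[fun ω => B ω * N ω, fun ω => B' ω * N' ω; μ] =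
      (∫ ω, B ω * B' ω ∂μ) * ∫ ω, N ω * N' ω ∂μ := by
  have hBN : IndepFun B N μ := hind.comp measurable_fst measurable_fst
  have hmul : IndepFun (fun ω => B ω * B' ω) (fun ω => N ω * N' ω) μ :=
    hind.comp measurable_mul measurable_mul
  rw [covariance_eq_sub (memLp_two_mul hB hN) (memLp_two_mul hB' hN'),
    hBN.integral_fun_mul_eq_mul_integral hB.1 hN.1, hN0, mul_zero, zero_mul, sub_zero,
    ← hmul.integral_fun_mul_eq_mul_integral (hB.1.mul hB'.1) (hN.1.mul hN'.1)]
  exact integral_congr_ae (ae_of_all _ fun ω => mul_mul_mul_comm _ _ _ _)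

lemma covariance_add_sq_add_sq [IsProbabilityMeasure μ]
    (hB : MemLp B 4 μ) (hB' : MemLp B' 4 μ) (hN : MemLp N 4 μ) (hN' : MemLp N' 4 μ) :
    cov[fun ω => (B ω + N ω) ^ 2, fun ω => (B' ω + N' ω) ^ 2; μ] =
      cov[fun ω => B ω ^ 2, fun ω => B' ω ^ 2; μ] + cov[fun ω => N ω ^ 2, fun ω => N' ω ^ 2; μ] +
      cov[fun ω => B ω ^ 2, fun ω => N' ω ^ 2; μ] + cov[fun ω => N ω ^ 2, fun ω => B' ω ^ 2; μ] +
      2 * (cov[fun ω => B ω ^ 2, fun ω => B' ω * N' ω; μ] +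
        cov[fun ω => N ω ^ 2, fun ω => B' ω * N' ω; μ] +
        cov[fun ω => B ω * N ω, fun ω => B' ω ^ 2; μ] +
        cov[fun ω => B ω * N ω, fun ω => N' ω ^ 2; μ]) +
      4 * cov[fun ω => B ω * N ω, fun ω => B' ω * N' ω; μ] := by
  have hsqB := memLp_two_sq hB
  have hsqB' := memLp_two_sq hB'
  have hsqN := memLp_two_sq hN
  have hsqN' := memLp_two_sq hN'
  have hBN := (memLp_two_mul hB hN).const_smul (2 : ℝ)
  have hBN' := (memLp_two_mul hB' hN').const_smul (2 : ℝ)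
  have hright := (hsqB'.add hBN').add hsqN'
  have hsq : ∀ X Y : Ω → ℝ, (fun ω => (X ω + Y ω) ^ 2) =
      (fun ω => X ω ^ 2) + (2 : ℝ) • (fun ω => X ω * Y ω) + fun ω => Y ω ^ 2 := fun X Y => by
    ext ω
    simp only [Pi.add_apply, Pi.smul_apply, smul_eq_mul]
    ring
  rw [hsq B N, hsq B' N', covariance_add_left (hsqB.add hBN) hsqN hright,
    covariance_add_left hsqB hBN hright, covariance_add_right hsqB (hsqB'.add hBN') hsqN',
    covariance_add_right hBN (hsqB'.add hBN') hsqN',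
    covariance_add_right hsqN (hsqB'.add hBN') hsqN', covariance_add_right hsqB hsqB' hBN',
    covariance_add_right hBN hsqB' hBN', covariance_add_right hsqN hsqB' hBN']
  simp only [covariance_smul_left, covariance_smul_right]
  ring

lemma covariance_add_sq_add_sq_of_indepFun [IsProbabilityMeasure μ]
    (hB : MemLp B 4 μ) (hB' : MemLp B' 4 μ) (hN : MemLp N 4 μ) (hN' : MemLp N' 4 μ)
    (hind : IndepFun (fun ω => (B ω, B' ω)) (fun ω => (N ω, N' ω)) μ)
    (hB0 : μ[B] = 0) (hB0' : μ[B'] = 0) (hN0 : μ[N] = 0) (hN0' : μ[N'] = 0) :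
    cov[fun ω => (B ω + N ω) ^ 2, fun ω => (B' ω + N' ω) ^ 2; μ] =
      cov[fun ω => B ω ^ 2, fun ω => B' ω ^ 2; μ] + cov[fun ω => N ω ^ 2, fun ω => N' ω ^ 2; μ] +
        4 * ((∫ ω, B ω * B' ω ∂μ) * ∫ ω, N ω * N' ω ∂μ) := by
  have msq : Measurable fun x : ℝ => x ^ 2 := by fun_prop
  have hBN := covariance_mul_eq_zero_of_indepFun (memLp_two_sq hB) hB'.1 hN'.1
    (memLp_two_mul hB' hN')
    (hind.comp (φ := fun x => (x.1 ^ 2, x.2)) (by fun_prop) measurable_snd) hN0'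
  have hBN' := covariance_mul_eq_zero_of_indepFun (memLp_two_sq hB') hB.1 hN.1 (memLp_two_mul hB hN)
    (hind.comp (φ := fun x => (x.2 ^ 2, x.1)) (by fun_prop) measurable_fst) hN0
  have hNB := covariance_mul_eq_zero_of_indepFun (memLp_two_sq hN) hN'.1 hB'.1
    (memLp_two_mul hN' hB')
    (hind.symm.comp (φ := fun x => (x.1 ^ 2, x.2)) (by fun_prop) measurable_snd) hB0'
  have hNB' := covariance_mul_eq_zero_of_indepFun (memLp_two_sq hN') hN.1 hB.1 (memLp_two_mul hN hB)
    (hind.symm.comp (φ := fun x => (x.2 ^ 2, x.1)) (by fun_prop) measurable_fst) hB0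
  simp_rw [mul_comm (N' _)] at hNB
  simp_rw [mul_comm (N _)] at hNB'
  rw [covariance_comm] at hBN' hNB'
  have hBsqN := (hind.comp (msq.comp measurable_fst) (msq.comp measurable_snd)).covariance_eq_zero
    (memLp_two_sq hB) (memLp_two_sq hN')
  have hNsqB := (hind.symm.comp (msq.comp measurable_fst)
    (msq.comp measurable_snd)).covariance_eq_zero (memLp_two_sq hN) (memLp_two_sq hB')
  simp only [Function.comp_def] at hBsqN hNsqB
  rw [covariance_add_sq_add_sq hB hB' hN hN', hBN, hBN', hNB, hNB', hBsqN, hNsqB,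
    covariance_mul_mul_of_indepFun hB hB' hN hN' hind hN0]
  ring

end Moments

section Kernels

lemma exists_abs_le_of_eventually_periodic {f : ℕ → ℝ} {T n₀ : ℕ} (hT : 0 < T)
    (hf : ∀ n, n₀ ≤ n → f (n + T) = f n) : ∃ B, ∀ n, |f n| ≤ B := by
  refine ⟨∑ i ∈ Finset.range (n₀ + T), |f i|, fun n => ?_⟩
  induction n using Nat.strong_induction_on with
  | _ n ih =>
    by_cases h : n < n₀ + T
    · exact Finset.single_le_sum (f := fun i => |f i|) (fun i _ => abs_nonneg _)
        (Finset.mem_range.2 h)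
    · have hshift := hf (n - T) (by omega)
      rw [Nat.sub_add_cancel (by omega)] at hshift
      exact hshift ▸ ih (n - T) (by omega)

lemma sum_range_add_eq_of_periodic {f : ℕ → ℝ} {T n₀ : ℕ} (hf : ∀ n, n₀ ≤ n → f (n + T) = f n)
    {n : ℕ} (hn : n₀ ≤ n) :
    ∑ r ∈ Finset.range T, f (n + r) = ∑ r ∈ Finset.range T, f (n₀ + r) := by
  induction n, hn using Nat.le_induction with
  | base => rfl
  | succ n hn ih =>
    have hlast := Finset.sum_range_succ (fun r => f (n + r)) T
    have hfirst := Finset.sum_range_succ' (fun r => f (n + r)) T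
    simp only [hf n hn, add_zero, ← add_assoc] at hlast hfirst
    simp only [add_right_comm n 1]
    linarith

lemma tendsto_cesaro_of_eventually_periodic {f : ℕ → ℝ} {T n₀ : ℕ} (hT : 0 < T)
    (hf : ∀ n, n₀ ≤ n → f (n + T) = f n) :
    Tendsto (fun n : ℕ => (∑ i ∈ Finset.range n, f i) / n) atTop
      (𝓝 ((∑ r ∈ Finset.range T, f (n₀ + r)) / T)) := by
  set mean := (∑ r ∈ Finset.range T, f (n₀ + r)) / T with hmean
  have hperiodic : ∀ n, n₀ ≤ n →
      ∑ i ∈ Finset.range (n + T), f i - ↑(n + T) * mean =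
        ∑ i ∈ Finset.range n, f i - n * mean := by
    intro n hn
    rw [Finset.sum_range_add, sum_range_add_eq_of_periodic hf hn, hmean]
    push_cast
    field_simp
    ring
  obtain ⟨B, hB⟩ := exists_abs_le_of_eventually_periodic
    (f := fun n => ∑ i ∈ Finset.range n, f i - n * mean) hT hperiodic
  have hzero := tendsto_bdd_div_atTop_nhds_zero (b := -B) (B := B)
    (Eventually.of_forall fun n => (abs_le.1 (hB n)).1)
    (Eventually.of_forall fun n => (abs_le.1 (hB n)).2) tendsto_natCast_atTop_atTop
  refine (zero_add mean ▸ hzero.add_const mean).congr' ?_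
  filter_upwards [eventually_gt_atTop 0] with n hn
  have hn' : (n : ℝ) ≠ 0 := by exact_mod_cast hn.ne'
  field_simp
  ring

lemma sum_range_mul {E : Type*} [AddCommMonoid E] (f : ℕ → E) (k P : ℕ) :
    ∑ j ∈ Finset.range (k * P), f j =
      ∑ q ∈ Finset.range k, ∑ r ∈ Finset.range P, f (q * P + r) := by
  induction k with
  | zero => simp
  | succ k ih => rw [Nat.succ_mul, Finset.sum_range_add, ih, Finset.sum_range_succ]

lemma sum_sum_range_eq_sum {R : Type*} [AddCommMonoid R] (ρ : ℕ → ℕ → R) (n : ℕ) :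
    ∑ i ∈ Finset.range n, ∑ j ∈ Finset.range n, ρ i j =
      ∑ i ∈ Finset.range n, (ρ i i + ∑ j ∈ Finset.range i, (ρ i j + ρ j i)) := by
  induction n with
  | zero => simp
  | succ n ih =>
    simp only [Finset.sum_range_succ _ n, Finset.sum_add_distrib] at ih ⊢
    rw [ih]
    abel

/-- A kernel on `ℕ` that is invariant under the diagonal shift by a period `T > 0` and vanishes at
distance at least `M` from the diagonal: the shape of the covariances of two periodic finite-range
functionals of an i.i.d. sequence. -/
structure IsBandedPeriodic (ρ : ℕ → ℕ → ℝ) (T M : ℕ) : Prop where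
  pos : 0 < T
  shift : ∀ i j, ρ (i + T) (j + T) = ρ i j
  eq_zero : ∀ i j, i + M ≤ j ∨ j + M ≤ i → ρ i j = 0

namespace IsBandedPeriodic

variable {ρ : ℕ → ℕ → ℝ} {T M : ℕ}

lemma swap (h : IsBandedPeriodic ρ T M) : IsBandedPeriodic (fun i j => ρ j i) T M :=
  ⟨h.pos, fun i j => h.shift j i, fun i j hij => h.eq_zero j i hij.symm⟩

lemma exists_abs_le (h : IsBandedPeriodic ρ T M) : ∃ B, ∀ i j, |ρ i j| ≤ B := by
  set B := ∑ p ∈ Finset.range (T + M) ×ˢ Finset.range (T + M), |ρ p.1 p.2|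
  have hB0 : 0 ≤ B := Finset.sum_nonneg fun _ _ => abs_nonneg _
  refine ⟨B, fun i => ?_⟩
  induction i using Nat.strong_induction_on with
  | _ i ih =>
    intro j
    by_cases hcorner : i < T + M ∧ j < T + M
    · exact Finset.single_le_sum (f := fun p : ℕ × ℕ => |ρ p.1 p.2|) (fun _ _ => abs_nonneg _)
        (Finset.mem_product.2
          ⟨Finset.mem_range.2 hcorner.1, Finset.mem_range.2 hcorner.2⟩ : (i, j) ∈ _)
    by_cases hband : i + M ≤ j ∨ j + M ≤ i
    · rwa [h.eq_zero i j hband, abs_zero]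
    · have hT := h.pos
      have hshift := h.shift (i - T) (j - T)
      rw [Nat.sub_add_cancel (by omega), Nat.sub_add_cancel (by omega)] at hshift
      exact hshift ▸ ih (i - T) (by omega) (j - T)

lemma exists_abs_sum_sum_le (h : IsBandedPeriodic ρ T M) :
    ∃ C, ∀ I J : Finset ℕ, |∑ i ∈ I, ∑ j ∈ J, ρ i j| ≤ C * I.card := by
  obtain ⟨B, hB⟩ := h.exists_abs_le
  have hB0 : 0 ≤ B := (abs_nonneg _).trans (hB 0 0)
  have hrow : ∀ (i : ℕ) (J : Finset ℕ), |∑ j ∈ J, ρ i j| ≤ 2 * M * B := by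
    intro i J
    have hsupp : ∑ j ∈ J, |ρ i j| = ∑ j ∈ J with j ∈ Finset.Ico (i - M) (i + M), |ρ i j| := by
      refine (Finset.sum_filter_of_ne fun j _ hj => ?_).symm
      by_contra hout
      exact hj (by rw [h.eq_zero i j (by rw [Finset.mem_Ico] at hout; omega), abs_zero])
    have hcard : ({j ∈ J | j ∈ Finset.Ico (i - M) (i + M)} : Finset ℕ).card ≤ 2 * M :=
      (Finset.card_le_card fun j hj => (Finset.mem_filter.1 hj).2).trans
        (by rw [Nat.card_Ico]; omega)
    calc |∑ j ∈ J, ρ i j| ≤ ∑ j ∈ J, |ρ i j| := Finset.abs_sum_le_sum_abs _ _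
      _ ≤ ({j ∈ J | j ∈ Finset.Ico (i - M) (i + M)} : Finset ℕ).card * B := by
          rw [hsupp, ← nsmul_eq_mul]
          exact Finset.sum_le_card_nsmul _ _ _ fun j _ => hB i j
      _ ≤ 2 * M * B := by
          gcongr
          exact_mod_cast hcard
  refine ⟨2 * M * B, fun I J => (Finset.abs_sum_le_sum_abs _ _).trans ?_⟩
  rw [mul_comm, ← nsmul_eq_mul]
  exact Finset.sum_le_card_nsmul _ _ _ fun i _ => hrow i J

lemma exists_tendsto_sum_sum_div (h : IsBandedPeriodic ρ T M) : ∃ l, Tendsto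
    (fun n : ℕ => (∑ i ∈ Finset.range n, ∑ j ∈ Finset.range n, ρ i j) / n) atTop (𝓝 l) := by
  simp only [sum_sum_range_eq_sum]
  refine ⟨_, tendsto_cesaro_of_eventually_periodic (n₀ := M) h.pos fun n hn => ?_⟩
  have hstart : ∑ j ∈ Finset.range T, (ρ (n + T) j + ρ j (n + T)) = 0 :=
    Finset.sum_eq_zero fun j hj => by
      have hj := Finset.mem_range.1 hj
      rw [h.eq_zero _ _ (.inr (by omega)), h.eq_zero _ _ (.inl (by omega)), add_zero]
  rw [add_comm n T, Finset.sum_range_add, add_comm T n, hstart, zero_add]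
  simp only [add_comm T, h.shift]

lemma tendsto_sum_sum_sub_div (h : IsBandedPeriodic ρ T M) {l : ℝ} (hl : Tendsto
    (fun n : ℕ => (∑ i ∈ Finset.range n, ∑ j ∈ Finset.range n, ρ i j) / n) atTop (𝓝 l))
    (p q : ℕ) : Tendsto
    (fun n : ℕ => (∑ i ∈ Finset.range (n - p), ∑ j ∈ Finset.range (n - q), ρ i j) / n)
      atTop (𝓝 l) := by
  obtain ⟨C, hC⟩ := h.exists_abs_sum_sum_le
  obtain ⟨C', hC'⟩ := h.swap.exists_abs_sum_sum_le
  have hC0 : 0 ≤ C := by simpa using (abs_nonneg _).trans (hC {0} {0})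
  have hC'0 : 0 ≤ C' := by simpa using (abs_nonneg _).trans (hC' {0} {0})
  have hcard : ∀ n m : ℕ, ((Finset.range n \ Finset.range (n - m)).card : ℝ) ≤ m := by
    intro n m
    rw [Finset.card_sdiff_of_subset (Finset.range_subset_range.2 (Nat.sub_le n m))]
    simp only [Finset.card_range, Nat.cast_le]
    omega
  have hbound : ∀ n, |∑ i ∈ Finset.range n, ∑ j ∈ Finset.range n, ρ i j -
      ∑ i ∈ Finset.range (n - p), ∑ j ∈ Finset.range (n - q), ρ i j| ≤ C * p + C' * q := by
    intro n
    rw [← Finset.sum_sdiff (Finset.range_subset_range.2 (Nat.sub_le n p)), add_sub_assoc,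
      ← Finset.sum_sub_distrib]
    simp only [← Finset.sum_sdiff_eq_sub (Finset.range_subset_range.2 (Nat.sub_le n q))]
    refine (abs_add_le _ _).trans (add_le_add ((hC _ _).trans ?_) ?_)
    · exact mul_le_mul_of_nonneg_left (hcard n p) hC0
    · rw [Finset.sum_comm]
      exact (hC' _ _).trans (mul_le_mul_of_nonneg_left (hcard n q) hC'0)
  have hzero := tendsto_bdd_div_atTop_nhds_zero
    (Eventually.of_forall fun n => (abs_le.1 (hbound n)).1)
    (Eventually.of_forall fun n => (abs_le.1 (hbound n)).2) tendsto_natCast_atTop_atTop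
  refine (sub_zero l ▸ hl.sub hzero).congr fun n => ?_
  ring

lemma shift_mul (h : IsBandedPeriodic ρ T M) (q i j : ℕ) :
    ρ (q * T + i) (q * T + j) = ρ i j := by
  induction q with
  | zero => simp
  | succ q ih =>
    rw [Nat.succ_mul, add_right_comm, add_right_comm _ T, h.shift, ih]

lemma tendsto_sum_sum_div_of_block (h : IsBandedPeriodic ρ T M)
    (hblock : ∀ q q' r r', r < T → r' < T → q ≠ q' → ρ (q * T + r) (q' * T + r') = 0) :
    Tendsto (fun n : ℕ => (∑ i ∈ Finset.range n, ∑ j ∈ Finset.range n, ρ i j) / n) atTop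
      (𝓝 ((∑ r ∈ Finset.range T, ∑ r' ∈ Finset.range T, ρ r r') / T)) := by
  obtain ⟨l, hl⟩ := h.exists_tendsto_sum_sum_div
  have hsubseq := hl.comp ((tendsto_id.atTop_mul_const' h.pos).comp (tendsto_add_atTop_nat 1))
  convert hl
  refine tendsto_nhds_unique (tendsto_const_nhds.congr fun k => ?_) hsubseq
  have hsum : ∑ i ∈ Finset.range ((k + 1) * T), ∑ j ∈ Finset.range ((k + 1) * T), ρ i j =
      (k + 1 : ℕ) * ∑ r ∈ Finset.range T, ∑ r' ∈ Finset.range T, ρ r r' := by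
    simp only [sum_range_mul]
    rw [Finset.sum_congr rfl fun q hq => Finset.sum_congr rfl fun r hr =>
      Finset.sum_eq_single_of_mem q hq fun q' _ hne => Finset.sum_eq_zero fun r' hr' =>
        hblock q q' r r' (Finset.mem_range.1 hr) (Finset.mem_range.1 hr') hne.symm]
    simp only [h.shift_mul, Finset.sum_const, Finset.card_range, nsmul_eq_mul]
  have hT : (T : ℝ) ≠ 0 := by exact_mod_cast h.pos.ne'
  simp only [Function.comp_apply, id_eq, hsum]
  push_cast
  field_simp

end IsBandedPeriodic

end Kernels

section BlockCLT

variable {Ω : Type*} [MeasurableSpace Ω] {μ : Measure Ω}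

lemma norm_exp_mul_I_sub_exp_mul_I_le (a b : ℝ) :
    ‖Complex.exp (a * Complex.I) - Complex.exp (b * Complex.I)‖ ≤ |a - b| := by
  have hfactor : Complex.exp (a * Complex.I) - Complex.exp (b * Complex.I) =
      Complex.exp (Complex.I * b) * (Complex.exp (Complex.I * ((a - b : ℝ) : ℂ)) - 1) := by
    rw [mul_sub, ← Complex.exp_add, mul_one]
    push_cast
    ring_nf
  rw [hfactor, norm_mul, Complex.norm_exp_I_mul_ofReal, one_mul]
  exact Real.norm_exp_I_mul_ofReal_sub_one_le

lemma integral_abs_le_sqrt_integral_sq [IsProbabilityMeasure μ] {X : Ω → ℝ} (hX : MemLp X 2 μ) :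
    ∫ ω, |X ω| ∂μ ≤ √(∫ ω, X ω ^ 2 ∂μ) := by
  refine Real.le_sqrt_of_sq_le ?_
  have hvar := variance_nonneg |X| μ
  rw [variance_eq_sub hX.abs] at hvar
  simpa using hvar

lemma norm_charFun_map_sub_le [IsProbabilityMeasure μ] {X Y : Ω → ℝ} (hX : MemLp X 2 μ)
    (hY : MemLp Y 2 μ) (t : ℝ) :
    ‖charFun (μ.map X) t - charFun (μ.map Y) t‖ ≤ |t| * √(∫ ω, (X ω - Y ω) ^ 2 ∂μ) := by
  have mX := hX.aestronglyMeasurable.aemeasurable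
  have mY := hY.aestronglyMeasurable.aemeasurable
  have hint : ∀ Z : Ω → ℝ, AEMeasurable Z μ →
      Integrable (fun ω => Complex.exp (((t * Z ω : ℝ) : ℂ) * Complex.I)) μ := by
    intro Z hZ
    refine Integrable.of_bound (C := 1) (by fun_prop) (ae_of_all _ fun ω => ?_)
    rw [Complex.norm_exp_ofReal_mul_I]
  rw [charFun_apply_real, charFun_apply_real, integral_map mX (by fun_prop),
    integral_map mY (by fun_prop)]
  simp_rw [← Complex.ofReal_mul]
  rw [← integral_sub (hint X mX) (hint Y mY)]
  calc _ ≤ ∫ ω, |t| * |X ω - Y ω| ∂μ := by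
        refine norm_integral_le_of_norm_le
          (((hX.sub hY).integrable (by simp)).abs.const_mul _)
          (ae_of_all _ fun ω => (norm_exp_mul_I_sub_exp_mul_I_le _ _).trans_eq ?_)
        rw [← mul_sub, abs_mul]
    _ = |t| * ∫ ω, |X ω - Y ω| ∂μ := integral_const_mul _ _
    _ ≤ _ := by
        gcongr
        exact integral_abs_le_sqrt_integral_sq (hX.sub hY)

lemma tendsto_of_forall_eventually_dist_le {α ι κ : Type*} [PseudoMetricSpace α] {f : Filter ι}
    {g : Filter κ} [g.NeBot] {u : ι → α} {v : κ → ι → α} {vlim : κ → α} {l : α} {b : κ → ℝ}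
    (hv : ∀ N, Tendsto (v N) f (𝓝 (vlim N))) (hvlim : Tendsto vlim g (𝓝 l))
    (hb : Tendsto b g (𝓝 0)) (h : ∀ N, ∀ᶠ n in f, dist (u n) (v N n) ≤ b N) :
    Tendsto u f (𝓝 l) := by
  refine Metric.tendsto_nhds.2 fun ε hε => ?_
  obtain ⟨N, hbN, hlN⟩ := ((hb.eventually_lt_const (show 0 < ε / 3 by positivity)).and
    (Metric.tendsto_nhds.1 hvlim (ε / 3) (by positivity))).exists
  filter_upwards [h N, Metric.tendsto_nhds.1 (hv N) (ε / 3) (by positivity)] with n h₁ h₂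
  calc dist (u n) l ≤ dist (u n) (v N n) + dist (v N n) (vlim N) + dist (vlim N) l :=
        dist_triangle4 _ _ _ _
    _ < ε := by linarith

lemma tendstoInDistribution_gaussianReal_of_approx [IsProbabilityMeasure μ] {X : ℕ → Ω → ℝ}
    {Y : ℕ → ℕ → Ω → ℝ} {v : ℕ → ℝ≥0} {γ : ℝ≥0} {b : ℕ → ℝ} (hX : ∀ n, MemLp (X n) 2 μ)
    (hY : ∀ N n, MemLp (Y N n) 2 μ)
    (hYlim : ∀ N, TendstoInDistribution (Y N) atTop (id : ℝ → ℝ) (fun _ => μ)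
      (gaussianReal 0 (v N)))
    (hv : Tendsto v atTop (𝓝 γ)) (hb : Tendsto b atTop (𝓝 0))
    (hXY : ∀ N, ∀ᶠ n in atTop, ∫ ω, (X n ω - Y N n ω) ^ 2 ∂μ ≤ b N) :
    TendstoInDistribution X atTop (id : ℝ → ℝ) (fun _ => μ) (gaussianReal 0 γ) := by
  refine ⟨fun n => (hX n).aestronglyMeasurable.aemeasurable, by fun_prop,
    ProbabilityMeasure.tendsto_iff_tendsto_charFun.2 fun t => ?_⟩
  have hYchar := fun N =>
    ProbabilityMeasure.tendsto_iff_tendsto_charFun.1 (hYlim N).tendsto t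
  simp only [ProbabilityMeasure.coe_mk, Measure.map_id, charFun_gaussianReal] at hYchar ⊢
  refine tendsto_of_forall_eventually_dist_le (g := atTop) (b := fun N => |t| * √(b N)) hYchar
    ?_ ?_ fun N => ?_
  · have hcont : Continuous fun w : ℝ≥0 =>
        Complex.exp (t * (0 : ℝ) * Complex.I - ((w : ℝ) : ℂ) * (t : ℂ) ^ 2 / 2) := by fun_prop
    exact (hcont.tendsto γ).comp hv
  · simpa using (hb.sqrt).const_mul |t|
  · filter_upwards [hXY N] with n hn
    rw [dist_eq_norm]
    exact (norm_charFun_map_sub_le (hX n) (hY N n) t).trans (by gcongr)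

lemma tendsto_natDiv_div {P : ℕ} (hP : 0 < P) :
    Tendsto (fun n : ℕ => ((n / P : ℕ) : ℝ) / n) atTop (𝓝 (P : ℝ)⁻¹) := by
  have h := (tendsto_nat_floor_mul_div_atTop (R := ℝ) (a := (P : ℝ)⁻¹) (by positivity)).comp
    tendsto_natCast_atTop_atTop
  refine h.congr fun n => ?_
  simp only [Function.comp_apply, inv_mul_eq_div, Nat.floor_div_eq_div]

lemma tendsto_natSub_div (p : ℕ) :
    Tendsto (fun n : ℕ => ((n - p : ℕ) : ℝ) / n) atTop (𝓝 1) := by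
  have h := (tendsto_const_nhds (x := (p : ℝ))).div_atTop tendsto_natCast_atTop_atTop
  refine (sub_zero (1 : ℝ) ▸ h.const_sub 1).congr' ?_
  filter_upwards [eventually_gt_atTop 0, eventually_ge_atTop p] with n hn hpn
  have hn' : (n : ℝ) ≠ 0 := by exact_mod_cast hn.ne'
  rw [Nat.cast_sub hpn, sub_div, div_self hn']

lemma hasLaw_sqrt_mul_gaussianReal_div {v a : ℝ} (hv : 0 ≤ v) (ha : 0 < a) :
    HasLaw (fun x => √a * x) (gaussianReal 0 v.toNNReal) (gaussianReal 0 (v / a).toNNReal) := by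
  have hscaled : NNReal.mk (√a ^ 2) (sq_nonneg _) * (v / a).toNNReal = v.toNNReal := by
    refine NNReal.eq ?_
    simp only [NNReal.coe_mul, NNReal.coe_mk, Real.coe_toNNReal _ hv,
      Real.coe_toNNReal _ (div_nonneg hv ha.le), Real.sq_sqrt ha.le]
    field_simp
  have h := gaussianReal_const_mul (HasLaw.id (μ := gaussianReal 0 (v / a).toNNReal)) √a
  rw [mul_zero] at h
  exact hscaled ▸ h

lemma tendstoInDistribution_inv_sqrt_mul_sum_range_div [IsProbabilityMeasure μ] {A : ℕ → Ω → ℝ}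
    {P : ℕ} (hP : 0 < P) (hA : MemLp (A 0) 2 μ) (hA0 : μ[A 0] = 0) (hind : iIndepFun A μ)
    (hid : ∀ q, IdentDistrib (A q) (A 0) μ μ) :
    TendstoInDistribution (fun (n : ℕ) ω => (√n)⁻¹ * ∑ q ∈ Finset.range (n / P), A q ω) atTop
      (id : ℝ → ℝ) (fun _ => μ) (gaussianReal 0 (Var[A 0; μ] / P).toNNReal) := by
  have hP' : (0 : ℝ) < P := by exact_mod_cast hP
  have hlaw := hasLaw_sqrt_mul_gaussianReal_div (variance_nonneg (A 0) μ) hP'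
  have hclt : TendstoInDistribution
      (fun n ω => (√(n / P : ℕ))⁻¹ * ∑ q ∈ Finset.range (n / P), A q ω) atTop
      (fun x => √P * x) (fun _ => μ) (gaussianReal 0 (Var[A 0; μ] / P).toNNReal) := by
    have h := tendstoInDistribution_inv_sqrt_mul_sum_sub hlaw hA hind hid
    simp only [hA0, mul_zero, sub_zero] at h
    exact ⟨fun n => h.forall_aemeasurable _, h.aemeasurable_limit,
      h.tendsto.comp (Nat.tendsto_div_const_atTop hP.ne')⟩
  have hscale : TendstoInMeasure μ (fun (n : ℕ) (_ : Ω) => √(((n / P : ℕ) : ℝ) / n)) atTop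
      (fun _ => √((P : ℝ)⁻¹)) :=
    tendstoInMeasure_of_tendsto_ae (fun _ => aestronglyMeasurable_const)
      (ae_of_all _ fun _ => (tendsto_natDiv_div hP).sqrt)
  have hslutsky := hclt.continuous_comp_prodMk_of_tendstoInMeasure_const
    (g := fun x : ℝ × ℝ => x.2 * x.1) (by fun_prop) hscale (fun _ => aemeasurable_const)
  refine hslutsky.congr (fun n => ?_) ?_
  · filter_upwards with ω
    rcases Nat.eq_zero_or_pos (n / P) with hk | hk
    · simp [hk]
    · have hk' : (0 : ℝ) < ((n / P : ℕ) : ℝ) := by exact_mod_cast hk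
      rw [Real.sqrt_div hk'.le]
      field_simp
  · filter_upwards with x
    rw [Real.sqrt_inv, inv_mul_cancel_left₀ (by positivity), id]

/-- The indices below `k * P` whose residue modulo `P` is less than `Q`: the first `k` blocks of
length `P`, each deprived of its last `P - Q` indices. In the blocking argument these gaps make the
block sums independent. -/
def blockIndices (P Q k : ℕ) : Finset ℕ := {j ∈ Finset.range (k * P) | j % P < Q}

lemma sum_blockIndices {E : Type*} [AddCommMonoid E] (f : ℕ → E) {P Q : ℕ} (hQ : Q ≤ P) (k : ℕ) :
    ∑ j ∈ blockIndices P Q k, f j =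
      ∑ q ∈ Finset.range k, ∑ r ∈ Finset.range Q, f (q * P + r) := by
  rw [blockIndices, Finset.sum_filter, sum_range_mul]
  refine Finset.sum_congr rfl fun q _ => ?_
  rw [← Finset.sum_subset (Finset.range_subset_range.2 hQ)]
  · refine Finset.sum_congr rfl fun r hr => if_pos ?_
    rw [Nat.mul_add_mod_self_right, Nat.mod_eq_of_lt (by grind)]
    exact Finset.mem_range.1 hr
  · intro r hr hrQ
    rw [Nat.mul_add_mod_self_right, Nat.mod_eq_of_lt (Finset.mem_range.1 hr), if_neg (by grind)]

lemma card_blockIndices {P Q : ℕ} (hQ : Q ≤ P) (k : ℕ) : (blockIndices P Q k).card = k * Q := by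
  rw [Finset.card_eq_sum_ones, sum_blockIndices _ hQ]
  simp

lemma card_range_sdiff_blockIndices_le {P : ℕ} (hP : 0 < P) (M n : ℕ) :
    (Finset.range n \ blockIndices P (P - M) (n / P)).card ≤ P + n / P * M := by
  have hsub : blockIndices P (P - M) (n / P) ⊆ Finset.range n :=
    (Finset.filter_subset _ _).trans (Finset.range_subset_range.2 (Nat.div_mul_le_self n P))
  rw [Finset.card_sdiff_of_subset hsub, card_blockIndices (Nat.sub_le _ _), Finset.card_range]
  have hgap : n / P * P ≤ n / P * (P - M) + n / P * M := by
    rw [← mul_add]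
    exact Nat.mul_le_mul_left _ (by omega)
  have hlast : n < n / P * P + P := Nat.lt_div_mul_add hP
  omega

variable {w : ℕ → Ω → ℝ} {C : ℝ}

lemma integral_sq_inv_sqrt_mul_sum_sub_le
    (hvar : ∀ I : Finset ℕ, ∫ ω, (∑ j ∈ I, w j ω) ^ 2 ∂μ ≤ C * I.card) {P n : ℕ} (hP : 0 < P)
    (M : ℕ) (hn : P * P ≤ n) :
    ∫ ω, ((√n)⁻¹ * ∑ j ∈ Finset.range n, w j ω -
      (√n)⁻¹ * ∑ j ∈ blockIndices P (P - M) (n / P), w j ω) ^ 2 ∂μ ≤ C * (M + 1) / P := by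
  have hC : 0 ≤ C := by simpa using (integral_nonneg fun ω => sq_nonneg _).trans (hvar {0})
  have hP' : (0 : ℝ) < P := by exact_mod_cast hP
  have hn' : (0 : ℝ) < n := by exact_mod_cast (Nat.mul_pos hP hP).trans_le hn
  have hsub : blockIndices P (P - M) (n / P) ⊆ Finset.range n :=
    (Finset.filter_subset _ _).trans (Finset.range_subset_range.2 (Nat.div_mul_le_self n P))
  simp only [← mul_sub, ← Finset.sum_sdiff_eq_sub hsub, mul_pow, integral_const_mul, inv_pow,
    Real.sq_sqrt hn'.le]
  have hcard : ((Finset.range n \ blockIndices P (P - M) (n / P)).card : ℝ) ≤ P + n / P * M := by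
    refine (Nat.cast_le.2 (card_range_sdiff_blockIndices_le hP M n)).trans ?_
    push_cast
    gcongr
    exact Nat.cast_div_le
  calc (n : ℝ)⁻¹ * ∫ ω, (∑ j ∈ Finset.range n \ blockIndices P (P - M) (n / P), w j ω) ^ 2 ∂μ
      ≤ (n : ℝ)⁻¹ * (C * (n / P + n / P * M)) := by
        gcongr
        refine (hvar _).trans ?_
        gcongr
        refine hcard.trans ?_
        gcongr
        rw [le_div_iff₀ hP']
        exact_mod_cast hn
    _ = C * (M + 1) / P := by
        field_simp
        ring

lemma tendsto_sub_div_of_tendsto_div {s : ℕ → ℝ} {γ : ℝ}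
    (hs : Tendsto (fun n : ℕ => s n / n) atTop (𝓝 γ)) (m : ℕ) :
    Tendsto (fun n : ℕ => s (n - m) / n) atTop (𝓝 γ) := by
  refine (mul_one γ ▸ (hs.comp (tendsto_sub_atTop_nat m)).mul (tendsto_natSub_div m)).congr' ?_
  filter_upwards [eventually_gt_atTop m] with n hn
  have hnm : ((n - m : ℕ) : ℝ) ≠ 0 := by exact_mod_cast (Nat.sub_pos_of_lt hn).ne'
  simp only [Function.comp_apply]
  field_simp

/-- Bernstein's blocking method: the partial sums are approximated in `L²` by independent sums over
long blocks separated by gaps of length `M`. -/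
theorem tendstoInDistribution_inv_sqrt_mul_sum_of_block [IsProbabilityMeasure μ] {γ : ℝ}
    {T M : ℕ} (hT : 0 < T) (hw : ∀ j, MemLp (w j) 2 μ) (hw0 : ∀ j, μ[w j] = 0)
    (hvar : ∀ I : Finset ℕ, ∫ ω, (∑ j ∈ I, w j ω) ^ 2 ∂μ ≤ C * I.card)
    (hγ : Tendsto (fun n : ℕ => (∫ ω, (∑ j ∈ Finset.range n, w j ω) ^ 2 ∂μ) / n) atTop (𝓝 γ))
    (hind : ∀ P, 0 < P → T ∣ P →
      iIndepFun (fun q ω => ∑ r ∈ Finset.range (P - M), w (q * P + r) ω) μ)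
    (hid : ∀ P q, T ∣ P → IdentDistrib
      (fun ω => ∑ r ∈ Finset.range (P - M), w (q * P + r) ω)
      (fun ω => ∑ r ∈ Finset.range (P - M), w r ω) μ μ) :
    TendstoInDistribution (fun (n : ℕ) ω => (√n)⁻¹ * ∑ j ∈ Finset.range n, w j ω) atTop
      (id : ℝ → ℝ) (fun _ => μ) (gaussianReal 0 γ.toNNReal) := by
  set P : ℕ → ℕ := fun N => (N + 1) * T
  have hP : ∀ N, 0 < P N := fun N => by positivity
  have hPlim : Tendsto P atTop atTop :=
    tendsto_atTop_mono (fun N => (Nat.le_succ N).trans (Nat.le_mul_of_pos_right _ hT)) tendsto_id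
  set A : ℕ → ℕ → Ω → ℝ := fun N q ω => ∑ r ∈ Finset.range (P N - M), w (q * P N + r) ω with hA
  have hsum : ∀ I : Finset ℕ, MemLp (fun ω => ∑ j ∈ I, w j ω) 2 μ :=
    fun I => memLp_finsetSum I fun j _ => hw j
  have hAmem : ∀ N q, MemLp (A N q) 2 μ := fun N q => memLp_finsetSum _ fun j _ => hw _
  have hA0 : ∀ N, A N 0 = fun ω => ∑ r ∈ Finset.range (P N - M), w r ω := fun N => by
    simp only [hA, zero_mul, zero_add]
  have hAmean : ∀ N, μ[A N 0] = 0 := fun N => by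
    simp only [hA, integral_finsetSum _ fun _ _ => (hw _).integrable one_le_two, hw0,
      Finset.sum_const_zero]
  have hblock : ∀ N n ω, ∑ q ∈ Finset.range (n / P N), A N q ω =
      ∑ j ∈ blockIndices (P N) (P N - M) (n / P N), w j ω := fun N n ω =>
    (sum_blockIndices (fun j => w j ω) (Nat.sub_le _ _) _).symm
  refine tendstoInDistribution_gaussianReal_of_approx (fun n => (hsum _).const_mul _)
    (fun N n => (memLp_finsetSum _ fun q _ => hAmem N q).const_mul _)
    (fun N => tendstoInDistribution_inv_sqrt_mul_sum_range_div (hP N) (hAmem N 0) (hAmean N)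
      (hind _ (hP N) (Dvd.intro_left _ rfl)) fun q => (hA0 N).symm ▸ hid _ q (Dvd.intro_left _ rfl))
    ?_ (b := fun N => C * (M + 1) / P N) ?_ fun N => ?_
  · refine (continuous_real_toNNReal.tendsto γ).comp ?_
    refine ((tendsto_sub_div_of_tendsto_div hγ M).comp hPlim).congr fun N => ?_
    rw [variance_of_integral_eq_zero (hAmem N 0).aestronglyMeasurable.aemeasurable (hAmean N), hA0,
      Function.comp_apply]
  · exact tendsto_const_nhds.div_atTop (tendsto_natCast_atTop_atTop.comp hPlim)
  · filter_upwards [eventually_ge_atTop (P N * P N)] with n hn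
    simp only [hblock]
    exact integral_sq_inv_sqrt_mul_sum_sub_le hvar (hP N) M hn

end BlockCLT

section PeriodicLocal

variable {E : Type*} [MeasurableSpace E] {F G : ℕ → (ℕ → E) → ℝ} {T M : ℕ}

/-- A sequence of measurable functionals of a path `z : ℕ → E` that is `T`-periodic, up to shifting
the path, and of finite range: the `j`-th functional only depends on `z j, …, z (j + M)`. -/
structure IsPeriodicLocal (F : ℕ → (ℕ → E) → ℝ) (T M : ℕ) : Prop where
  pos : 0 < T
  measurable : ∀ j, Measurable (F j)
  shift : ∀ j z, F (j + T) z = F j (fun r => z (T + r))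
  congr : ∀ j z z', (∀ r ≤ M, z (j + r) = z' (j + r)) → F j z = F j z'

namespace IsPeriodicLocal

lemma shift_mul (hF : IsPeriodicLocal F T M) (j q : ℕ) (z : ℕ → E) :
    F (j + q * T) z = F j (fun r => z (q * T + r)) := by
  induction q generalizing z with
  | zero => simp
  | succ q ih =>
    rw [Nat.succ_mul, ← add_assoc, hF.shift, ih]
    simp only [add_comm T, add_right_comm]

lemma sum_range_add_mul (hF : IsPeriodicLocal F T M) {P : ℕ} (hP : T ∣ P) (q m : ℕ) (z : ℕ → E) :
    ∑ r ∈ Finset.range m, F (q * P + r) z =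
      ∑ r ∈ Finset.range m, F r (fun s => z (q * P + s)) := by
  obtain ⟨k, rfl⟩ := hP
  refine Finset.sum_congr rfl fun r _ => ?_
  rw [show q * (T * k) = q * k * T by ring, add_comm]
  exact hF.shift_mul r (q * k) z

lemma const_mul_sub_const_mul (hF : IsPeriodicLocal F T M) (hG : IsPeriodicLocal G T M) (a b : ℝ) :
    IsPeriodicLocal (fun j z => a * F j z - b * G j z) T M where
  pos := hF.pos
  measurable j := ((hF.measurable j).const_mul a).sub ((hG.measurable j).const_mul b)
  shift j z := by rw [hF.shift, hG.shift]
  congr j z z' h := by rw [hF.congr j z z' h, hG.congr j z z' h]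

lemma sub_const (hF : IsPeriodicLocal F T M) {c : ℕ → ℝ} (hc : ∀ j, c (j + T) = c j) :
    IsPeriodicLocal (fun j z => F j z - c j) T M where
  pos := hF.pos
  measurable j := (hF.measurable j).sub_const _
  shift j z := by rw [hF.shift, hc]
  congr j z z' h := by rw [hF.congr j z z' h]

variable {Ω : Type*} [MeasurableSpace Ω] {μ : Measure Ω} {Z : ℕ → Ω → E}

lemma integral_add_period (hF : IsPeriodicLocal F T M) (hZ : iIndepFun Z μ)
    (hZd : ∀ j, IdentDistrib (Z j) (Z 0) μ μ) (j : ℕ) :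
    ∫ ω, F (j + T) (fun r => Z r ω) ∂μ = ∫ ω, F j (fun r => Z r ω) ∂μ := by
  simp only [hF.shift]
  exact (identDistrib_shift hZ hZd (hF.measurable j) T).integral_eq

lemma covariance_add_period (hF : IsPeriodicLocal F T M) (hG : IsPeriodicLocal G T M)
    (hZ : iIndepFun Z μ) (hZd : ∀ j, IdentDistrib (Z j) (Z 0) μ μ) (i j : ℕ) :
    cov[fun ω => F (i + T) (fun r => Z r ω), fun ω => G (j + T) (fun r => Z r ω); μ] =
      cov[fun ω => F i (fun r => Z r ω), fun ω => G j (fun r => Z r ω); μ] := by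
  simp only [hF.shift, hG.shift]
  have hpair := identDistrib_shift hZ hZd ((hF.measurable i).prodMk (hG.measurable j)) T
  have hmap := hpair.map_eq
  have hcov := fun {U : Ω → ℝ × ℝ} (hU : AEMeasurable U μ) =>
    covariance_map_fun (X := Prod.fst) (Y := Prod.snd)
      measurable_fst.aestronglyMeasurable measurable_snd.aestronglyMeasurable hU
  rw [← hcov hpair.aemeasurable_fst, ← hcov hpair.aemeasurable_snd, hmap]

lemma indepFun_of_add_lt (hF : IsPeriodicLocal F T M) (hG : IsPeriodicLocal G T M)
    (hZ : iIndepFun Z μ) (mZ : ∀ j, AEMeasurable (Z j) μ) {i j : ℕ} (hij : i + M < j) :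
    IndepFun (fun ω => F i (fun r => Z r ω)) (fun ω => G j (fun r => Z r ω)) μ := by
  -- The two functionals read two consecutive blocks of length `j - i` of the path from time `i` on.
  have hblocks := iIndepFun_block (P := j - i) (fun r => mZ (i + r))
    (hZ.precomp (add_right_injective i)) (by omega)
    (G := fun z : ℕ → E => (F i (fun r => z (r - i)), G j (fun r => z (r - j))))
    (((hF.measurable i).comp (measurable_pi_lambda _ fun r => measurable_pi_apply _)).prodMk
      ((hG.measurable j).comp (measurable_pi_lambda _ fun r => measurable_pi_apply _)))
    fun z z' h => Prod.ext (hF.congr _ _ _ fun r hr => h _ (by omega))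
      (hG.congr _ _ _ fun r hr => h _ (by omega))
  refine ((hblocks.indepFun zero_ne_one).comp measurable_fst measurable_snd).congr
    (ae_of_all _ fun ω => hF.congr _ _ _ fun r _ => ?_)
    (ae_of_all _ fun ω => hG.congr _ _ _ fun r _ => ?_)
  · simp only [zero_mul, zero_add, Nat.add_sub_cancel_left]
  · simp only [one_mul]
    rw [show i + (j - i + (j + r - j)) = j + r by omega]

lemma isBandedPeriodic_covariance (hF : IsPeriodicLocal F T M) (hG : IsPeriodicLocal G T M)
    (hZ : iIndepFun Z μ) (hZd : ∀ j, IdentDistrib (Z j) (Z 0) μ μ)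
    (hF2 : ∀ j, MemLp (fun ω => F j (fun r => Z r ω)) 2 μ)
    (hG2 : ∀ j, MemLp (fun ω => G j (fun r => Z r ω)) 2 μ) :
    IsBandedPeriodic (fun i j =>
      cov[fun ω => F i (fun r => Z r ω), fun ω => G j (fun r => Z r ω); μ]) T (M + 1) where
  pos := hF.pos
  shift := hF.covariance_add_period hG hZ hZd
  eq_zero i j hij := by
    have mZ : ∀ j, AEMeasurable (Z j) μ := fun j => (hZd j).aemeasurable_fst
    rcases hij with hij | hij
    · exact (hF.indepFun_of_add_lt hG hZ mZ (by omega)).covariance_eq_zero (hF2 i) (hG2 j)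
    · rw [covariance_comm]
      exact (hG.indepFun_of_add_lt hF hZ mZ (by omega)).covariance_eq_zero (hG2 j) (hF2 i)

theorem tendstoInDistribution_inv_sqrt_mul_sum [IsProbabilityMeasure μ]
    (hF : IsPeriodicLocal F T M)
    (hZ : iIndepFun Z μ) (hZd : ∀ j, IdentDistrib (Z j) (Z 0) μ μ)
    (hF2 : ∀ j, MemLp (fun ω => F j (fun r => Z r ω)) 2 μ) {γ : ℝ}
    (hγ : Tendsto (fun n : ℕ => Var[fun ω => ∑ j ∈ Finset.range n, F j (fun r => Z r ω); μ] / n)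
      atTop (𝓝 γ)) :
    TendstoInDistribution (fun (n : ℕ) ω => (√n)⁻¹ * ∑ j ∈ Finset.range n,
        (F j (fun r => Z r ω) - ∫ ω', F j (fun r => Z r ω') ∂μ)) atTop
      (id : ℝ → ℝ) (fun _ => μ) (gaussianReal 0 γ.toNNReal) := by
  have mZ : ∀ j, AEMeasurable (Z j) μ := fun j => (hZd j).aemeasurable_fst
  have hFc := hF.sub_const (c := fun j => ∫ ω, F j (fun r => Z r ω) ∂μ)
    (hF.integral_add_period hZ hZd)
  obtain ⟨C, hC⟩ := (hF.isBandedPeriodic_covariance hF hZ hZd hF2 hF2).exists_abs_sum_sum_le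
  have hsum : ∀ I : Finset ℕ, MemLp (fun ω => ∑ j ∈ I, F j (fun r => Z r ω)) 2 μ :=
    fun I => memLp_finsetSum I fun j _ => hF2 j
  have hsq := fun I : Finset ℕ => integral_sq_sum_sub_integral I fun j _ => hF2 j
  have hmeas : ∀ P, Measurable fun z : ℕ → E => ∑ r ∈ Finset.range (P - M),
      (F r z - ∫ ω', F r (fun s => Z s ω') ∂μ) :=
    fun P => Finset.measurable_sum _ fun r _ => hFc.measurable r
  refine tendstoInDistribution_inv_sqrt_mul_sum_of_block (C := C) (M := M) hF.pos
    (fun j => (hF2 j).sub (memLp_const _)) (fun j => ?_) (fun I => ?_) ?_ (fun P hP hTP => ?_)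
    (fun P q hTP => ?_)
  · rw [integral_sub ((hF2 j).integrable one_le_two) (integrable_const _)]
    simp
  · rw [hsq, ← covariance_self (hsum I).aestronglyMeasurable.aemeasurable,
      covariance_fun_sum_fun_sum' (fun j _ => hF2 j) (fun j _ => hF2 j)]
    exact (le_abs_self _).trans (hC I I)
  · simpa only [hsq] using hγ
  · simp only [hFc.sum_range_add_mul hTP]
    exact iIndepFun_block mZ hZ hP (hmeas P) fun z z' h => Finset.sum_congr rfl fun r hr =>
      hFc.congr r z z' fun s hs => h _ (by grind)
  · simp only [hFc.sum_range_add_mul hTP]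
    exact identDistrib_shift hZ hZd (hmeas P) (q * P)

end IsPeriodicLocal

end PeriodicLocal

section Schemes

/-- The distance between the beginnings of two consecutive price increments. -/
def Scheme.step : Scheme → ℕ → ℕ
  | .overlapping, _ => 1
  | .nonOverlapping, L => L
  | .disjoint, L => L + 1

lemma Scheme.start_eq (v : Scheme) (L i : ℕ) : v.start L i = i * v.step L := by
  cases v <;> simp only [Scheme.start, Scheme.step] <;> ring

lemma Scheme.zeta_eq (v : Scheme) (L : ℕ) : v.zeta L = v.step L := by
  cases v <;> simp [Scheme.zeta, Scheme.step]

lemma Scheme.step_pos (v : Scheme) {L : ℕ} (hL : 0 < L) : 0 < v.step L := by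
  cases v <;> simp only [Scheme.step] <;> omega

lemma Scheme.lt_count_iff (v : Scheme) {L : ℕ} (hL : 0 < L) (n i : ℕ) :
    i < v.count n L ↔ i * v.step L < n - L := by
  cases v <;> simp only [Scheme.count, Scheme.step]
  · omega
  · rw [← Nat.add_one_le_iff, Nat.le_div_iff_mul_le hL, add_mul]
    omega
  · rw [← Nat.add_one_le_iff, Nat.le_div_iff_mul_le L.add_one_pos, add_mul]
    omega

lemma sum_range_ite_dvd {s k N : ℕ} (hs : 0 < s) (hk : ∀ i, i < k ↔ i * s < N) (f : ℕ → ℝ) :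
    ∑ j ∈ Finset.range N, (if s ∣ j then f j else 0) = ∑ i ∈ Finset.range k, f (i * s) := by
  rw [← Finset.sum_filter]
  refine (Finset.sum_nbij (· * s) (fun i hi => ?_) (fun i _ j _ h => ?_) (fun j hj => ?_)
    fun _ _ => rfl).symm
  · simpa [← hk] using hi
  · exact Nat.eq_of_mul_eq_mul_right hs h
  · obtain ⟨hjN, i, rfl⟩ := by simpa using hj
    exact ⟨i, by simpa [hk, mul_comm] using hjN, mul_comm _ _⟩

lemma Scheme.sum_range_count (v : Scheme) {L : ℕ} (hL : 0 < L) (n : ℕ) (f : ℕ → ℝ) :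
    ∑ i ∈ Finset.range (v.count n L), f (v.start L i) =
      ∑ j ∈ Finset.range (n - L), if v.step L ∣ j then f j else 0 := by
  simp only [v.start_eq, sum_range_ite_dvd (v.step_pos hL) (v.lt_count_iff hL n)]

lemma Scheme.count_pos (v : Scheme) {L n : ℕ} (hL : 0 < L) (hn : L < n) : 0 < v.count n L :=
  (v.lt_count_iff hL n 0).2 (by omega)

lemma Scheme.le_count_mul_step_add (v : Scheme) {L : ℕ} (hL : 0 < L) (n : ℕ) :
    n ≤ v.count n L * v.step L + L := by
  have := (v.lt_count_iff hL n _).not.1 (lt_irrefl (v.count n L))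
  omega

lemma Scheme.count_mul_step_le_add (v : Scheme) {L : ℕ} (hL : 0 < L) (n : ℕ) :
    v.count n L * v.step L ≤ n + v.step L := by
  rcases h : v.count n L with _ | k
  · simp
  · have := (v.lt_count_iff hL n k).1 (by omega)
    rw [Nat.succ_mul]
    omega

lemma Scheme.tendsto_count_div (v : Scheme) {L : ℕ} (hL : 0 < L) :
    Tendsto (fun n : ℕ => (v.count n L : ℝ) / n) atTop (𝓝 (v.step L : ℝ)⁻¹) := by
  have hs : (0 : ℝ) < v.step L := by exact_mod_cast v.step_pos hL
  have hdiff : Tendsto (fun n : ℕ => ((v.count n L : ℝ) * v.step L - n) / n) atTop (𝓝 0) := by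
    refine tendsto_bdd_div_atTop_nhds_zero (b := -L) (B := v.step L)
      (.of_forall fun n => ?_) (.of_forall fun n => ?_) tendsto_natCast_atTop_atTop
    · have : (n : ℝ) ≤ v.count n L * v.step L + L := by exact_mod_cast v.le_count_mul_step_add hL n
      linarith
    · have : (v.count n L * v.step L : ℝ) ≤ n + v.step L := by
        exact_mod_cast v.count_mul_step_le_add hL n
      linarith
  have hlim := (hdiff.add_const 1).mul_const (v.step L : ℝ)⁻¹
  rw [zero_add, one_mul] at hlim
  refine hlim.congr' ?_
  filter_upwards [eventually_gt_atTop 0] with n hn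
  have hn' : (n : ℝ) ≠ 0 := by exact_mod_cast hn.ne'
  field_simp
  ring

lemma Scheme.tendsto_div_count (v : Scheme) {L : ℕ} (hL : 0 < L) :
    Tendsto (fun n : ℕ => (n : ℝ) / v.count n L) atTop (𝓝 (v.step L)) := by
  have hs : (v.step L : ℝ) ≠ 0 := by exact_mod_cast (v.step_pos hL).ne'
  simpa using (v.tendsto_count_div hL).inv₀ (inv_ne_zero hs)

end Schemes

section SquaredIncrementKernel

/-- The length of the intersection of the windows `[i, i + L]` and `[j, j + L']`, the subtraction
truncating to `0` when they do not meet. -/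
def overlap (L L' i j : ℕ) : ℕ :=
  min (i + L) (j + L') - max i j

/-- The covariance of the squared increments over `[i, i + L]` and `[j, j + L']`, where `s` is the
variance of the diffusive part per unit of time and `e` the variance of the noise. -/
noncomputable def sqCov (s e : ℝ) (L L' i j : ℕ) : ℝ :=
  2 * (s * overlap L L' i j) ^ 2 +
    4 * (s * overlap L L' i j) *
      (e * ((if i + L = j + L' then 1 else 0) + (if i = j then 1 else 0))) +
    (if i = j ∧ L = L' then 4 * e ^ 2 else 0)

variable {s e : ℝ} {L L' : ℕ}

lemma sqCov_comm (i j : ℕ) : sqCov s e L L' i j = sqCov s e L' L j i := by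
  simp only [sqCov, overlap, min_comm (i + L), max_comm i, eq_comm (a := i + L),
    eq_comm (a := i), eq_comm (a := L)]

lemma sqCov_add (i j T : ℕ) : sqCov s e L L' (i + T) (j + T) = sqCov s e L L' i j := by
  have hoverlap : overlap L L' (i + T) (j + T) = overlap L L' i j := by
    simp only [overlap]
    omega
  simp only [sqCov, hoverlap, add_right_comm _ T, add_left_inj]

lemma sqCov_eq_zero (hL : 0 < L) (hL' : 0 < L') {i j : ℕ} (h : i + L ≤ j ∨ j + L' ≤ i) :
    sqCov s e L L' i j = 0 := by
  have hoverlap : overlap L L' i j = 0 := by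
    simp only [overlap]
    omega
  simp [sqCov, hoverlap, show ¬(i = j ∧ L = L') by omega]

lemma sqCov_self (i : ℕ) :
    sqCov s e L L i i = 2 * s ^ 2 * L ^ 2 + 8 * s * L * e + 4 * e ^ 2 := by
  simp only [sqCov, overlap, min_self, max_self, Nat.add_sub_cancel_left, if_true, and_self]
  ring

lemma sqCov_self_of_lt {i j : ℕ} (hij : i < j) :
    sqCov s e L L i j = 2 * s ^ 2 * ((i + L - j : ℕ) : ℝ) ^ 2 := by
  have hoverlap : overlap L L i j = i + L - j := by
    simp only [overlap]
    omega
  simp only [sqCov, hoverlap, add_left_inj, hij.ne, if_false, false_and]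
  ring

/-- The covariance kernel of the squared increments selected by a scheme, indexed by the instants at
which the increments start; the instants that do not start an increment contribute `0`. -/
noncomputable def Scheme.selectedSqCov (v : Scheme) (s e : ℝ) (L L' i j : ℕ) : ℝ :=
  if v.step L ∣ i ∧ v.step L' ∣ j then sqCov s e L L' i j else 0

lemma Scheme.isBandedPeriodic_selectedSqCov (v : Scheme) {T : ℕ} (hL : 0 < L) (hL' : 0 < L')
    (hT : 0 < T) (h : v.step L ∣ T) (h' : v.step L' ∣ T) :
    IsBandedPeriodic (v.selectedSqCov s e L L') T (max L L') where
  pos := hT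
  shift i j := by
    simp only [Scheme.selectedSqCov, sqCov_add, Nat.dvd_add_left h, Nat.dvd_add_left h']
  eq_zero i j hij := ite_eq_right_iff.2 fun _ => sqCov_eq_zero hL hL' (by omega)

lemma Scheme.tendsto_sum_sum_selectedSqCov_div_of_step_mul (v : Scheme) (hL : 0 < L) (hL' : 0 < L')
    (hLs : L ≤ v.step L) (hLs' : L' ≤ v.step L') {m : ℕ} (hm : v.step L' = m * v.step L) :
    Tendsto (fun n : ℕ =>
        (∑ i ∈ Finset.range n, ∑ j ∈ Finset.range n, v.selectedSqCov s e L L' i j) / n) atTop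
      (𝓝 ((∑ a ∈ Finset.range m, sqCov s e L L' (a * v.step L) 0) / v.step L')) := by
  have hs := v.step_pos hL
  have hs' := v.step_pos hL'
  have hdvd : v.step L ∣ v.step L' := hm ▸ Dvd.intro_left _ rfl
  have hbanded := v.isBandedPeriodic_selectedSqCov (s := s) (e := e) hL hL' hs' hdvd dvd_rfl
  convert hbanded.tendsto_sum_sum_div_of_block ?_ using 3
  · rw [← sum_range_ite_dvd hs (N := v.step L') (fun i => by rw [hm, Nat.mul_lt_mul_right hs])
      fun j => sqCov s e L L' j 0]
    refine Finset.sum_congr rfl fun r _ => ?_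
    refine ((Finset.sum_eq_single_of_mem 0 (Finset.mem_range.2 hs') fun r' hr' hr0 =>
      if_neg fun h => hr0 (Nat.eq_zero_of_dvd_of_lt h.2 (Finset.mem_range.1 hr'))).trans ?_).symm
    simp only [dvd_zero, and_true]
  · intro q q' r r' hr hr' hne
    refine ite_eq_right_iff.2 fun ⟨hi, hj⟩ => sqCov_eq_zero hL hL' ?_
    -- The window starting at `q * step L' + r` ends before the next multiple of `step L'`.
    have hr_le : r + v.step L ≤ v.step L' := by
      rw [Nat.dvd_add_right (hdvd.mul_left q)] at hi
      have := Nat.le_of_dvd (by omega) (Nat.dvd_sub hdvd hi)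
      omega
    have hr'0 : r' = 0 :=
      Nat.eq_zero_of_dvd_of_lt ((Nat.dvd_add_right (Dvd.intro_left _ rfl)).1 hj) hr'
    rcases hne.lt_or_gt with hlt | hlt
    · have := Nat.mul_le_mul_right (v.step L') (Nat.succ_le_of_lt hlt)
      rw [Nat.succ_mul] at this
      omega
    · have := Nat.mul_le_mul_right (v.step L') (Nat.succ_le_of_lt hlt)
      rw [Nat.succ_mul] at this
      omega

lemma sum_range_sub_sq (L m : ℕ) :
    ∑ j ∈ Finset.range (m + L), ((j + L - (m + L) : ℕ) : ℝ) ^ 2 =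
      ((L : ℝ) - 1) * L * (2 * L - 1) / 6 := by
  have htail : ∀ j, m + j + L - (m + L) = j := by omega
  rw [Finset.sum_range_add, Finset.sum_eq_zero fun j hj => ?_, zero_add]
  · simp only [htail]
    induction L with
    | zero => simp
    | succ L ih =>
      rw [Finset.sum_range_succ, ih fun j => by omega]
      push_cast
      ring
  · rw [show j + L - (m + L) = 0 by grind]
    simp

lemma tendsto_sum_sum_selectedSqCov_overlapping_div :
    Tendsto (fun n : ℕ => (∑ i ∈ Finset.range n, ∑ j ∈ Finset.range n,
      Scheme.overlapping.selectedSqCov s e L L i j) / n) atTop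
      (𝓝 (2 / 3 * s ^ 2 * L * (1 + 2 * L ^ 2) + 8 * s * L * e + 4 * e ^ 2)) := by
  simp only [sum_sum_range_eq_sum, div_eq_inv_mul]
  refine (tendsto_const_nhds.congr' ?_).cesaro
  filter_upwards [eventually_ge_atTop L] with n hn
  obtain ⟨m, rfl⟩ := Nat.exists_eq_add_of_le' hn
  simp only [Scheme.selectedSqCov, Scheme.step, one_dvd, and_self, if_true, sqCov_self,
    sqCov_comm (m + L), ← two_mul]
  rw [Finset.sum_congr rfl fun j hj => by rw [sqCov_self_of_lt (Finset.mem_range.1 hj)],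
    ← Finset.mul_sum, ← Finset.mul_sum, sum_range_sub_sq]
  ring

lemma Scheme.tendsto_sum_sum_selectedSqCov_self_div (v : Scheme) (σ S : ℝ) (τ : ℝ≥0) (hL : 0 < L) :
    Tendsto (fun n : ℕ => (∑ i ∈ Finset.range n, ∑ j ∈ Finset.range n,
      v.selectedSqCov (σ ^ 2 * τ) (S ^ 2 / 4) L L i j) / n) atTop
      (𝓝 (sigmaSq σ S τ v L / v.step L)) := by
  have hlarge (hLs : L ≤ v.step L) := v.tendsto_sum_sum_selectedSqCov_div_of_step_mul
    (s := σ ^ 2 * τ) (e := S ^ 2 / 4) hL hL hLs hLs (one_mul _).symm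
  simp only [Finset.sum_range_one, zero_mul, sqCov_self] at hlarge
  cases v
  case overlapping =>
    convert tendsto_sum_sum_selectedSqCov_overlapping_div (s := σ ^ 2 * τ) (e := S ^ 2 / 4) using 2
    simp only [sigmaSq, Scheme.step]
    push_cast
    ring
  all_goals
    convert hlarge (by simp [Scheme.step]) using 3
    simp only [sigmaSq]
    ring

lemma tendsto_sum_sum_selectedSqCov_disjoint_div {m : ℕ} (hL : 0 < L) (hm : 2 ≤ m)
    (h : L' + 1 = m * (L + 1)) :
    Tendsto (fun n : ℕ => (∑ i ∈ Finset.range n, ∑ j ∈ Finset.range n,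
      Scheme.disjoint.selectedSqCov s e L L' i j) / n) atTop
      (𝓝 ((2 * m * s ^ 2 * L ^ 2 + 8 * s * L * e) / (L' + 1))) := by
  have hLL' : L < L' := by nlinarith
  convert Scheme.disjoint.tendsto_sum_sum_selectedSqCov_div_of_step_mul hL (hL.trans hLL') L.le_succ
    L'.le_succ h using 3
  · have hterm : ∀ a ∈ Finset.range m, sqCov s e L L' (a * (L + 1)) 0 = 2 * s ^ 2 * L ^ 2 +
        4 * s * L * e * ((if a = m - 1 then 1 else 0) + if a = 0 then 1 else 0) := fun a ha => by
      have hle := Nat.mul_le_mul_right (L + 1) (Finset.mem_range.1 ha)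
      rw [Nat.succ_mul] at hle
      have hoverlap : overlap L L' (a * (L + 1)) 0 = L := by
        simp only [overlap]
        omega
      have hend : a * (L + 1) + L = 0 + L' ↔ a = m - 1 := by
        have hsucc : a + 1 = m ↔ (a + 1) * (L + 1) = m * (L + 1) :=
          (Nat.mul_left_inj L.add_one_ne_zero).symm
        rw [Nat.succ_mul, ← h] at hsucc
        omega
      simp only [sqCov, hoverlap, hend, Nat.mul_eq_zero, L.succ_ne_zero, or_false,
        hLL'.ne, and_false, if_false]
      ring
    rw [Scheme.step, Finset.sum_congr rfl hterm, Finset.sum_add_distrib, Finset.sum_const,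
      Finset.card_range, nsmul_eq_mul, ← Finset.mul_sum, Finset.sum_add_distrib,
      Finset.sum_ite_eq', Finset.sum_ite_eq',
      if_pos (Finset.mem_range.2 (by omega)), if_pos (Finset.mem_range.2 (by omega))]
    ring
  · simp [Scheme.step]

end SquaredIncrementKernel

section Innovations

variable {Ω : Type*} [MeasurableSpace Ω] {μ : Measure Ω} {D H : ℕ → Ω → ℝ} {s : ℝ≥0} {e : ℝ}

/-- The randomness driving the prices on a regular grid: `D j` is the increment of the mid price
between the instants `j` and `j + 1`, and `H j` is the noise at the instant `j`. Noise of constant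
absolute value `√e` is encoded by `H j ^ 2 = e`. -/
structure IsInnovation (D H : ℕ → Ω → ℝ) (s : ℝ≥0) (e : ℝ) (μ : Measure Ω) : Prop where
  diffusion_law : ∀ j, HasLaw (D j) (gaussianReal 0 s) μ
  diffusion_indep : iIndepFun D μ
  noise_identDistrib : ∀ j, IdentDistrib (H j) (H 0) μ μ
  noise_indep : iIndepFun H μ
  noise_mean : ∀ j, μ[H j] = 0
  noise_sq : ∀ j, ∀ᵐ ω ∂μ, H j ω ^ 2 = e
  indep : IndepFun (fun ω j => D j ω) (fun ω j => H j ω) μ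

namespace IsInnovation

lemma isProbabilityMeasure (h : IsInnovation D H s e μ) : IsProbabilityMeasure μ :=
  h.noise_indep.isProbabilityMeasure

lemma aemeasurable_diffusion (h : IsInnovation D H s e μ) (j : ℕ) : AEMeasurable (D j) μ :=
  (h.diffusion_law j).aemeasurable

lemma aemeasurable_noise (h : IsInnovation D H s e μ) (j : ℕ) : AEMeasurable (H j) μ :=
  (h.noise_identDistrib j).aemeasurable_fst

lemma iIndepFun_prodMk (h : IsInnovation D H s e μ) : iIndepFun (fun j ω => (D j ω, H j ω)) μ :=
  BidAskSpread.iIndepFun_prodMk h.aemeasurable_diffusion h.aemeasurable_noise h.diffusion_indep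
    h.noise_indep h.indep

lemma identDistrib_prodMk (h : IsInnovation D H s e μ) (j : ℕ) :
    IdentDistrib (fun ω => (D j ω, H j ω)) (fun ω => (D 0 ω, H 0 ω)) μ μ := by
  have := h.isProbabilityMeasure
  have hindep : ∀ i, IndepFun (D i) (H i) μ := fun i =>
    h.indep.comp (measurable_pi_apply i) (measurable_pi_apply i)
  exact ((h.diffusion_law j).identDistrib (h.diffusion_law 0)).prodMk (h.noise_identDistrib j)
    (hindep j) (hindep 0)

section Diffusion

lemma hasGaussianLaw_diffusion (h : IsInnovation D H s e μ) (j : ℕ) : HasGaussianLaw (D j) μ :=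
  (h.diffusion_law j).hasGaussianLaw

lemma covariance_diffusion (h : IsInnovation D H s e μ) (i j : ℕ) :
    cov[D i, D j; μ] = if i = j then (s : ℝ) else 0 := by
  have := h.isProbabilityMeasure
  split_ifs with hij
  · rw [← hij, covariance_self (h.aemeasurable_diffusion i), (h.diffusion_law i).variance_eq,
      variance_id_gaussianReal]
  · exact (h.diffusion_indep.indepFun hij).covariance_eq_zero
      (h.hasGaussianLaw_diffusion i).memLp_two (h.hasGaussianLaw_diffusion j).memLp_two

lemma hasGaussianLaw_sum_prodMk_sum (h : IsInnovation D H s e μ) (I J : Finset ℕ) :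
    HasGaussianLaw (fun ω => (∑ t ∈ I, D t ω, ∑ t ∈ J, D t ω)) μ := by
  have hjoint := iIndepFun.hasGaussianLaw (fun t : ↥(I ∪ J) => h.hasGaussianLaw_diffusion t)
    (h.diffusion_indep.precomp Subtype.val_injective)
  let sumOver (K : Finset ℕ) (hK : K ⊆ I ∪ J) : (↥(I ∪ J) → ℝ) →L[ℝ] ℝ :=
    ∑ t : K, ContinuousLinearMap.proj (R := ℝ) (φ := fun _ => ℝ) ⟨t, hK t.2⟩
  have hsum : ∀ K hK ω, sumOver K hK (fun t => D t ω) = ∑ t ∈ K, D t ω := fun K hK ω => by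
    simp [sumOver, Finset.sum_attach K fun t => D t ω]
  simpa only [ContinuousLinearMap.prod_apply, hsum] using hjoint.map_fun
    ((sumOver I Finset.subset_union_left).prod (sumOver J Finset.subset_union_right))

lemma hasGaussianLaw_sum_diffusion (h : IsInnovation D H s e μ) (I : Finset ℕ) :
    HasGaussianLaw (fun ω => ∑ t ∈ I, D t ω) μ :=
  (h.hasGaussianLaw_sum_prodMk_sum I I).fst

lemma integral_sum_diffusion (h : IsInnovation D H s e μ) (I : Finset ℕ) :
    ∫ ω, ∑ t ∈ I, D t ω ∂μ = 0 := by
  rw [integral_finsetSum _ fun t _ => (h.hasGaussianLaw_diffusion t).integrable]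
  refine Finset.sum_eq_zero fun t _ => ?_
  rw [(h.diffusion_law t).integral_eq, integral_id_gaussianReal]

lemma covariance_sum_diffusion (h : IsInnovation D H s e μ) (I J : Finset ℕ) :
    cov[fun ω => ∑ t ∈ I, D t ω, fun ω => ∑ t ∈ J, D t ω; μ] = s * (I ∩ J).card := by
  have := h.isProbabilityMeasure
  rw [covariance_fun_sum_fun_sum' (fun t _ => (h.hasGaussianLaw_diffusion t).memLp_two)
    (fun t _ => (h.hasGaussianLaw_diffusion t).memLp_two)]
  simp only [h.covariance_diffusion, Finset.sum_ite_eq, ← Finset.sum_filter,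
    Finset.filter_mem_eq_inter, Finset.sum_const, nsmul_eq_mul]
  exact mul_comm _ _

end Diffusion

section Noise

lemma memLp_noise (h : IsInnovation D H s e μ) (j : ℕ) (p : ENNReal) : MemLp (H j) p μ := by
  have := h.isProbabilityMeasure
  refine MemLp.of_bound (h.aemeasurable_noise j).aestronglyMeasurable (√e) ?_
  filter_upwards [h.noise_sq j] with ω hω
  rw [← hω, Real.sqrt_sq_eq_abs, Real.norm_eq_abs]

lemma memLp_noise_sub (h : IsInnovation D H s e μ) (a b : ℕ) (p : ENNReal) :
    MemLp (fun ω => H a ω - H b ω) p μ :=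
  (h.memLp_noise a p).sub (h.memLp_noise b p)

lemma integral_noise_mul (h : IsInnovation D H s e μ) (a b : ℕ) :
    ∫ ω, H a ω * H b ω ∂μ = if a = b then e else 0 := by
  have := h.isProbabilityMeasure
  split_ifs with hab
  · simp only [hab, ← pow_two, integral_congr_ae (h.noise_sq b), integral_const, probReal_univ,
      one_smul]
  · rw [(h.noise_indep.indepFun hab).integral_fun_mul_eq_mul_integral
      (h.memLp_noise a 1).1 (h.memLp_noise b 1).1, h.noise_mean, zero_mul]

lemma integral_noise_sub (h : IsInnovation D H s e μ) (a b : ℕ) :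
    ∫ ω, (H a ω - H b ω) ∂μ = 0 := by
  have := h.isProbabilityMeasure
  rw [integral_sub ((h.memLp_noise a 1).integrable le_rfl) ((h.memLp_noise b 1).integrable le_rfl),
    h.noise_mean, h.noise_mean, sub_zero]

lemma integral_noise_sub_mul (h : IsInnovation D H s e μ) (a b c d : ℕ) :
    ∫ ω, (H a ω - H b ω) * (H c ω - H d ω) ∂μ =
      e * ((if a = c then 1 else 0) + (if b = d then 1 else 0)
        - (if a = d then 1 else 0) - (if b = c then 1 else 0)) := by
  have := h.isProbabilityMeasure
  have hint : ∀ a b, Integrable (fun ω => H a ω * H b ω) μ := fun a b =>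
    (h.memLp_noise a 2).integrable_mul (h.memLp_noise b 2)
  have hexpand : ∀ ω, (H a ω - H b ω) * (H c ω - H d ω) =
      (H a ω * H c ω + H b ω * H d ω) - (H a ω * H d ω + H b ω * H c ω) := fun ω => by ring
  have hpos : Integrable (fun ω => H a ω * H c ω + H b ω * H d ω) μ := (hint a c).add (hint b d)
  have hneg : Integrable (fun ω => H a ω * H d ω + H b ω * H c ω) μ := (hint a d).add (hint b c)
  simp_rw [hexpand]
  rw [integral_sub hpos hneg, integral_add (hint a c) (hint b d),
    integral_add (hint a d) (hint b c)]
  simp only [h.integral_noise_mul]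
  split_ifs <;> ring

lemma covariance_noise_mul_eq_zero (h : IsInnovation D H s e μ) {a b c d : ℕ} (ha : a ≠ d)
    (hb : b ≠ d) (hc : c ≠ d) :
    cov[fun ω => H a ω * H b ω, fun ω => H c ω * H d ω; μ] = 0 := by
  have := h.isProbabilityMeasure
  refine covariance_mul_eq_zero_of_indepFun (memLp_two_mul (h.memLp_noise a 4) (h.memLp_noise b 4))
    (h.memLp_noise c 1).1 (h.memLp_noise d 1).1
    (memLp_two_mul (h.memLp_noise c 4) (h.memLp_noise d 4)) ?_ (h.noise_mean d)
  have hindep := h.noise_indep.indepFun_finset₀ {a, b, c} {d} (by simp [ha.symm, hb.symm, hc.symm])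
    h.aemeasurable_noise
  exact hindep.comp
    (φ := fun z : ({a, b, c} : Finset ℕ) → ℝ =>
      (z ⟨a, by simp⟩ * z ⟨b, by simp⟩, z ⟨c, by simp⟩))
    (ψ := fun z : ({d} : Finset ℕ) → ℝ => z ⟨d, by simp⟩) (by fun_prop) (by fun_prop)

lemma covariance_noise_mul_mul (h : IsInnovation D H s e μ) {a b c d : ℕ} (hab : a < b)
    (hcd : c < d) :
    cov[fun ω => H a ω * H b ω, fun ω => H c ω * H d ω; μ] =
      if a = c ∧ b = d then e ^ 2 else 0 := by
  have := h.isProbabilityMeasure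
  split_ifs with hpair
  · obtain ⟨rfl, rfl⟩ := hpair
    have hmem := memLp_two_mul (h.memLp_noise a 4) (h.memLp_noise b 4)
    rw [covariance_eq_sub hmem hmem, h.integral_noise_mul, if_neg hab.ne, mul_zero, sub_zero,
      integral_congr_ae (g := fun _ => e ^ 2)]
    · simp
    · filter_upwards [h.noise_sq a, h.noise_sq b] with ω ha hb
      rw [Pi.mul_apply, ← pow_two, mul_pow, ha, hb, pow_two]
  · by_cases hd : a ≠ d ∧ b ≠ d
    · exact h.covariance_noise_mul_eq_zero hd.1 hd.2 hcd.ne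
    · simp only [mul_comm (H c _)]
      exact h.covariance_noise_mul_eq_zero (by omega) (by omega) hcd.ne'

lemma noise_sub_sq_ae_eq (h : IsInnovation D H s e μ) (a b : ℕ) :
    (fun ω => (H b ω - H a ω) ^ 2) =ᵐ[μ] fun ω => 2 * e - 2 * (H a ω * H b ω) := by
  filter_upwards [h.noise_sq a, h.noise_sq b] with ω ha hb
  linear_combination ha + hb

lemma covariance_noise_sub_sq (h : IsInnovation D H s e μ) {a b c d : ℕ} (hab : a < b)
    (hcd : c < d) :
    cov[fun ω => (H b ω - H a ω) ^ 2, fun ω => (H d ω - H c ω) ^ 2; μ] =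
      if a = c ∧ b = d then 4 * e ^ 2 else 0 := by
  have := h.isProbabilityMeasure
  have hint : ∀ a b, Integrable (fun ω => 2 * (H a ω * H b ω)) μ := fun a b =>
    ((h.memLp_noise a 2).integrable_mul (h.memLp_noise b 2)).const_mul 2
  rw [covariance_congr_ae (h.noise_sub_sq_ae_eq a b) (h.noise_sub_sq_ae_eq c d),
    covariance_const_sub_left (hint a b), covariance_const_sub_right (hint c d),
    covariance_const_mul_left, covariance_const_mul_right, h.covariance_noise_mul_mul hab hcd]
  split_ifs <;> ring

end Noise

end IsInnovation

end Innovations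

section PriceIncrements

/-- The price increment between the instants `j` and `j + L`, as a function of the path of the
innovations: `(z t).1` is the diffusive increment between `t` and `t + 1`, and `(z t).2` the noise
at `t`. -/
def windowIncrement (L j : ℕ) (z : ℕ → ℝ × ℝ) : ℝ :=
  ∑ t ∈ Finset.Ico j (j + L), (z t).1 + ((z (j + L)).2 - (z j).2)

lemma measurable_windowIncrement (L j : ℕ) : Measurable (windowIncrement L j) := by
  unfold windowIncrement
  fun_prop

lemma windowIncrement_add (L j T : ℕ) (z : ℕ → ℝ × ℝ) :
    windowIncrement L (j + T) z = windowIncrement L j fun r => z (T + r) := by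
  simp only [windowIncrement, Finset.sum_Ico_eq_sum_range, Nat.add_sub_cancel_left, add_comm j T,
    add_assoc T j, Nat.add_sub_add_left]

lemma windowIncrement_congr {L j : ℕ} {z z' : ℕ → ℝ × ℝ} (h : ∀ r ≤ L, z (j + r) = z' (j + r)) :
    windowIncrement L j z = windowIncrement L j z' := by
  rw [windowIncrement, windowIncrement, Finset.sum_Ico_eq_sum_range, Finset.sum_Ico_eq_sum_range,
    h L le_rfl, show z j = z' j from h 0 L.zero_le,
    Finset.sum_congr rfl fun r hr => by rw [h r (by grind)]]

/-- The squared price increment over the window starting at `j` when the scheme selects this window,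
and `0` otherwise. -/
def Scheme.sqIncrement (v : Scheme) (L j : ℕ) (z : ℕ → ℝ × ℝ) : ℝ :=
  if v.step L ∣ j then windowIncrement L j z ^ 2 else 0

lemma Scheme.isPeriodicLocal_sqIncrement (v : Scheme) {L T M : ℕ} (hT : 0 < T) (h : v.step L ∣ T)
    (hM : L ≤ M) : IsPeriodicLocal (v.sqIncrement L) T M where
  pos := hT
  measurable j := by
    unfold Scheme.sqIncrement
    split_ifs
    exacts [(measurable_windowIncrement L j).pow_const 2, measurable_const]
  shift j z := by simp only [Scheme.sqIncrement, windowIncrement_add, Nat.dvd_add_left h]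
  congr j z z' hz := by
    rw [Scheme.sqIncrement, windowIncrement_congr fun r hr => hz r (hr.trans hM),
      Scheme.sqIncrement]

namespace IsInnovation

variable {Ω : Type*} [MeasurableSpace Ω] {μ : Measure Ω} {D H : ℕ → Ω → ℝ} {s : ℝ≥0} {e : ℝ}
  {L L' : ℕ}

lemma memLp_windowIncrement (h : IsInnovation D H s e μ) (L j : ℕ) :
    MemLp (fun ω => windowIncrement L j fun r => (D r ω, H r ω)) 4 μ :=
  ((h.hasGaussianLaw_sum_diffusion _).memLp (by simp)).add
    (h.memLp_noise_sub _ _ 4)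

lemma indepFun_sum_diffusion_noise_sub (h : IsInnovation D H s e μ) (I J : Finset ℕ)
    (a b c d : ℕ) :
    IndepFun (fun ω => (∑ t ∈ I, D t ω, ∑ t ∈ J, D t ω))
      (fun ω => (H a ω - H b ω, H c ω - H d ω)) μ :=
  h.indep.comp (φ := fun z : ℕ → ℝ => (∑ t ∈ I, z t, ∑ t ∈ J, z t))
    (ψ := fun z : ℕ → ℝ => (z a - z b, z c - z d)) (by fun_prop) (by fun_prop)

lemma integral_windowIncrement (h : IsInnovation D H s e μ) (L j : ℕ) :
    ∫ ω, windowIncrement L j (fun r => (D r ω, H r ω)) ∂μ = 0 := by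
  have := h.isProbabilityMeasure
  simp only [windowIncrement]
  rw [integral_add (h.hasGaussianLaw_sum_diffusion _).integrable
    ((h.memLp_noise_sub _ _ 1).integrable le_rfl), h.integral_sum_diffusion,
    h.integral_noise_sub, add_zero]

lemma variance_windowIncrement (h : IsInnovation D H s e μ) (hL : 0 < L) (j : ℕ) :
    Var[fun ω => windowIncrement L j fun r => (D r ω, H r ω); μ] = s * L + 2 * e := by
  have := h.isProbabilityMeasure
  have hB := h.hasGaussianLaw_sum_diffusion (Finset.Ico j (j + L))
  have hN := h.memLp_noise_sub (j + L) j 2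
  have hindep := (h.indepFun_sum_diffusion_noise_sub (Finset.Ico j (j + L)) ∅ (j + L) j 0 0).comp
    measurable_fst measurable_fst
  have hvarB := h.covariance_sum_diffusion (Finset.Ico j (j + L)) (Finset.Ico j (j + L))
  rw [covariance_self hB.aemeasurable, Finset.inter_self, Nat.card_Ico,
    Nat.add_sub_cancel_left] at hvarB
  have hvarN : Var[fun ω => H (j + L) ω - H j ω; μ] = 2 * e := by
    have hmul := h.integral_noise_sub_mul (j + L) j (j + L) j
    simp only [← pow_two, Nat.add_eq_left, hL.ne', Nat.left_eq_add, if_true, if_false] at hmul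
    rw [variance_of_integral_eq_zero hN.aemeasurable (h.integral_noise_sub _ _), hmul]
    ring
  rw [← hvarB, ← hvarN]
  exact hindep.variance_add hB.memLp_two hN

lemma integral_windowIncrement_sq (h : IsInnovation D H s e μ) (hL : 0 < L) (j : ℕ) :
    ∫ ω, windowIncrement L j (fun r => (D r ω, H r ω)) ^ 2 ∂μ = s * L + 2 * e := by
  rw [← h.variance_windowIncrement hL j, variance_of_integral_eq_zero
    (h.memLp_windowIncrement L j).aemeasurable (h.integral_windowIncrement L j)]

lemma covariance_windowIncrement_sq (h : IsInnovation D H s e μ) (hL : 0 < L) (hL' : 0 < L')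
    (i j : ℕ) :
    cov[fun ω => windowIncrement L i (fun r => (D r ω, H r ω)) ^ 2,
      fun ω => windowIncrement L' j (fun r => (D r ω, H r ω)) ^ 2; μ] = sqCov s e L L' i j := by
  have := h.isProbabilityMeasure
  have hB := h.hasGaussianLaw_sum_diffusion
  have hcov := h.covariance_sum_diffusion (Finset.Ico i (i + L)) (Finset.Ico j (j + L'))
  rw [Finset.Ico_inter_Ico, Nat.card_Ico, ← overlap] at hcov
  have hprod := hcov
  rw [covariance_eq_sub (hB _).memLp_two (hB _).memLp_two, h.integral_sum_diffusion, zero_mul,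
    sub_zero] at hprod
  simp only [Pi.mul_apply] at hprod
  simp only [windowIncrement]
  rw [covariance_add_sq_add_sq_of_indepFun ((hB _).memLp (by simp)) ((hB _).memLp (by simp))
      (h.memLp_noise_sub _ _ 4) (h.memLp_noise_sub _ _ 4)
      (h.indepFun_sum_diffusion_noise_sub _ _ _ _ _ _)
      (h.integral_sum_diffusion _) (h.integral_sum_diffusion _) (h.integral_noise_sub _ _)
      (h.integral_noise_sub _ _),
    covariance_sq_sq_of_hasGaussianLaw (h.hasGaussianLaw_sum_prodMk_sum _ _)
      (h.integral_sum_diffusion _) (h.integral_sum_diffusion _), hcov, hprod,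
    h.covariance_noise_sub_sq (by omega) (by omega), h.integral_noise_sub_mul, sqCov]
  by_cases hadj : i + L = j ∨ i = j + L'
  · have hoverlap : overlap L L' i j = 0 := by
      simp only [overlap]
      omega
    simp [hoverlap, show ¬(i = j ∧ i + L = j + L') by omega, show ¬(i = j ∧ L = L') by omega]
  · rw [not_or] at hadj
    simp only [hadj.1, hadj.2, if_false,
      show (i = j ∧ i + L = j + L') ↔ (i = j ∧ L = L') by omega]
    ring

lemma memLp_sqIncrement (h : IsInnovation D H s e μ) (v : Scheme) (L j : ℕ) :
    MemLp (fun ω => v.sqIncrement L j fun r => (D r ω, H r ω)) 2 μ := by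
  have := h.isProbabilityMeasure
  unfold Scheme.sqIncrement
  split_ifs
  exacts [memLp_two_sq (h.memLp_windowIncrement L j), memLp_const 0]

lemma integral_sqIncrement (h : IsInnovation D H s e μ) (v : Scheme) (hL : 0 < L) (j : ℕ) :
    ∫ ω, v.sqIncrement L j (fun r => (D r ω, H r ω)) ∂μ =
      if v.step L ∣ j then s * L + 2 * e else 0 := by
  unfold Scheme.sqIncrement
  split_ifs
  exacts [h.integral_windowIncrement_sq hL j, integral_zero _ _]

lemma covariance_sqIncrement (h : IsInnovation D H s e μ) (v : Scheme) (hL : 0 < L)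
    (hL' : 0 < L') (i j : ℕ) :
    cov[fun ω => v.sqIncrement L i fun r => (D r ω, H r ω),
      fun ω => v.sqIncrement L' j fun r => (D r ω, H r ω); μ] =
      v.selectedSqCov s e L L' i j := by
  have := h.isProbabilityMeasure
  unfold Scheme.sqIncrement Scheme.selectedSqCov
  by_cases hi : v.step L ∣ i <;> by_cases hj : v.step L' ∣ j <;>
    simp [hi, hj, h.covariance_windowIncrement_sq hL hL']

end IsInnovation

end PriceIncrements

section VarianceConvergence

variable {Ω : Type*} [MeasurableSpace Ω] {μ : Measure Ω}

lemma variance_const_mul_sub_const_mul [IsProbabilityMeasure μ] {X Y : Ω → ℝ} (hX : MemLp X 2 μ)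
    (hY : MemLp Y 2 μ) (a b : ℝ) :
    Var[fun ω => a * X ω - b * Y ω; μ] =
      a ^ 2 * Var[X; μ] + b ^ 2 * Var[Y; μ] - 2 * (a * b) * cov[X, Y; μ] := by
  rw [variance_fun_sub (hX.const_mul a) (hY.const_mul b), variance_const_mul, variance_const_mul,
    covariance_const_mul_left, covariance_const_mul_right]
  ring

lemma tendsto_mul_variance_const_mul_sub_const_mul [IsProbabilityMeasure μ] {X Y : ℕ → Ω → ℝ}
    {w : ℕ → ℝ} {c c' d : ℝ} (hX : ∀ n, MemLp (X n) 2 μ) (hY : ∀ n, MemLp (Y n) 2 μ)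
    (hc : Tendsto (fun n => w n * Var[X n; μ]) atTop (𝓝 c))
    (hc' : Tendsto (fun n => w n * Var[Y n; μ]) atTop (𝓝 c'))
    (hd : Tendsto (fun n => w n * cov[X n, Y n; μ]) atTop (𝓝 d)) (a b : ℝ) :
    Tendsto (fun n => w n * Var[fun ω => a * X n ω - b * Y n ω; μ]) atTop
      (𝓝 (a ^ 2 * c + b ^ 2 * c' - 2 * (a * b) * d)) := by
  refine (((hc.const_mul (a ^ 2)).add (hc'.const_mul (b ^ 2))).sub
    (hd.const_mul (2 * (a * b)))).congr fun n => ?_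
  rw [variance_const_mul_sub_const_mul (hX n) (hY n)]
  ring

lemma variance_const_mul_sub_const_mul_le [IsProbabilityMeasure μ] {X Y : Ω → ℝ}
    (hX : MemLp X 2 μ) (hY : MemLp Y 2 μ) (a b : ℝ) :
    Var[fun ω => a * X ω - b * Y ω; μ] ≤ 2 * a ^ 2 * Var[X; μ] + 2 * b ^ 2 * Var[Y; μ] := by
  have hparallelogram := variance_nonneg (fun ω => a * X ω - -b * Y ω) μ
  rw [variance_const_mul_sub_const_mul hX hY] at hparallelogram ⊢
  linarith

lemma tendstoInMeasure_sub_integral_of_variance [IsProbabilityMeasure μ] {X : ℕ → Ω → ℝ}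
    (hX : ∀ n, MemLp (X n) 2 μ) (hvar : Tendsto (fun n => Var[X n; μ]) atTop (𝓝 0)) :
    TendstoInMeasure μ (fun n ω => X n ω - ∫ ω', X n ω' ∂μ) atTop fun _ => 0 := by
  rw [tendstoInMeasure_iff_norm]
  intro ε hε
  have hbound : Tendsto (fun n => ENNReal.ofReal (Var[X n; μ] / ε ^ 2)) atTop (𝓝 0) := by
    simpa using ENNReal.tendsto_ofReal (hvar.div_const (ε ^ 2))
  refine tendsto_of_tendsto_of_tendsto_of_le_of_le tendsto_const_nhds hbound
    (fun _ => zero_le) fun n => ?_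
  simpa only [sub_zero, Real.norm_eq_abs] using meas_ge_le_variance_div_sq (hX n) hε

lemma tendsto_corr_of_tendsto_natCast_mul {X Y : ℕ → Ω → ℝ} {c c' d : ℝ} (hc : 0 < c)
    (hc' : 0 < c') (hX : Tendsto (fun n : ℕ => n * Var[X n; μ]) atTop (𝓝 c))
    (hY : Tendsto (fun n : ℕ => n * Var[Y n; μ]) atTop (𝓝 c'))
    (hXY : Tendsto (fun n : ℕ => n * cov[X n, Y n; μ]) atTop (𝓝 d)) :
    Tendsto (fun n => corr μ (X n) (Y n)) atTop (𝓝 (d / (√c * √c'))) := by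
  refine (hXY.div (hX.sqrt.mul hY.sqrt) (by positivity)).congr' ?_
  filter_upwards [eventually_gt_atTop 0] with n hn
  have hn0 : (0 : ℝ) < n := by exact_mod_cast hn
  rw [Pi.div_apply, corr, Real.sqrt_mul hn0.le, Real.sqrt_mul hn0.le, mul_mul_mul_comm,
    Real.mul_self_sqrt hn0.le, mul_div_mul_left _ _ hn0.ne']

end VarianceConvergence

section EmpiricalVariance

/-- The empirical variance of the price increments selected by a scheme, as a function of the path
of the innovations. -/
noncomputable def Scheme.pathVar (v : Scheme) (n L : ℕ) (z : ℕ → ℝ × ℝ) : ℝ :=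
  (v.count n L : ℝ)⁻¹ * ∑ j ∈ Finset.range (n - L), v.sqIncrement L j z

lemma Scheme.pathVar_eq (v : Scheme) {L : ℕ} (hL : 0 < L) (n : ℕ) (z : ℕ → ℝ × ℝ) :
    v.pathVar n L z = (v.count n L : ℝ)⁻¹ *
      ∑ i ∈ Finset.range (v.count n L), windowIncrement L (v.start L i) z ^ 2 := by
  rw [Scheme.pathVar, v.sum_range_count hL n fun j => windowIncrement L j z ^ 2]
  rfl

namespace IsInnovation

variable {Ω : Type*} [MeasurableSpace Ω] {μ : Measure Ω} {D H : ℕ → Ω → ℝ} {s : ℝ≥0} {e : ℝ}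
  {L L' : ℕ}

lemma memLp_sum_sqIncrement (h : IsInnovation D H s e μ) (v : Scheme) (L p : ℕ) :
    MemLp (fun ω => ∑ j ∈ Finset.range p, v.sqIncrement L j fun r => (D r ω, H r ω)) 2 μ :=
  memLp_finsetSum _ fun j _ => h.memLp_sqIncrement v L j

lemma covariance_sum_sqIncrement (h : IsInnovation D H s e μ) (v : Scheme) (hL : 0 < L)
    (hL' : 0 < L') (p q : ℕ) :
    cov[fun ω => ∑ i ∈ Finset.range p, v.sqIncrement L i fun r => (D r ω, H r ω),
      fun ω => ∑ j ∈ Finset.range q, v.sqIncrement L' j fun r => (D r ω, H r ω); μ] =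
      ∑ i ∈ Finset.range p, ∑ j ∈ Finset.range q, v.selectedSqCov s e L L' i j := by
  have := h.isProbabilityMeasure
  rw [covariance_fun_sum_fun_sum' (fun i _ => h.memLp_sqIncrement v L i)
    (fun j _ => h.memLp_sqIncrement v L' j)]
  simp only [h.covariance_sqIncrement v hL hL']

lemma memLp_pathVar (h : IsInnovation D H s e μ) (v : Scheme) (n L : ℕ) :
    MemLp (fun ω => v.pathVar n L fun r => (D r ω, H r ω)) 2 μ :=
  (h.memLp_sum_sqIncrement v L (n - L)).const_mul _

lemma integral_pathVar (h : IsInnovation D H s e μ) (v : Scheme) {n : ℕ} (hL : 0 < L)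
    (hn : L < n) :
    ∫ ω, v.pathVar n L (fun r => (D r ω, H r ω)) ∂μ = s * L + 2 * e := by
  have := h.isProbabilityMeasure
  have hcount : (v.count n L : ℝ) ≠ 0 := by exact_mod_cast (v.count_pos hL hn).ne'
  simp only [Scheme.pathVar]
  rw [integral_const_mul,
    integral_finsetSum _ fun j _ => (h.memLp_sqIncrement v L j).integrable one_le_two]
  simp only [h.integral_sqIncrement v hL]
  rw [← v.sum_range_count hL n fun _ => s * L + 2 * e, Finset.sum_const, Finset.card_range,
    nsmul_eq_mul, inv_mul_cancel_left₀ hcount]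

lemma tendsto_mul_covariance_pathVar (h : IsInnovation D H s e μ) (v : Scheme) (hL : 0 < L)
    (hL' : 0 < L') {l : ℝ} (hl : Tendsto (fun n : ℕ => (∑ i ∈ Finset.range n,
      ∑ j ∈ Finset.range n, v.selectedSqCov s e L L' i j) / n) atTop (𝓝 l)) :
    Tendsto (fun n : ℕ => n * cov[fun ω => v.pathVar n L fun r => (D r ω, H r ω),
      fun ω => v.pathVar n L' fun r => (D r ω, H r ω); μ]) atTop
      (𝓝 (v.step L * v.step L' * l)) := by
  have hbanded := v.isBandedPeriodic_selectedSqCov (s := s) (e := e) hL hL'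
    (Nat.mul_pos (v.step_pos hL) (v.step_pos hL')) (Nat.dvd_mul_right _ _) (Nat.dvd_mul_left _ _)
  refine (((v.tendsto_div_count hL).mul (v.tendsto_div_count hL')).mul
    (hbanded.tendsto_sum_sum_sub_div hl L L')).congr' ?_
  filter_upwards [eventually_gt_atTop 0] with n hn
  have hn0 : (n : ℝ) ≠ 0 := by exact_mod_cast hn.ne'
  simp only [Scheme.pathVar]
  rw [covariance_const_mul_left, covariance_const_mul_right,
    h.covariance_sum_sqIncrement v hL hL']
  field_simp

lemma tendsto_mul_variance_pathVar (h : IsInnovation D H s e μ) (v : Scheme) (hL : 0 < L) {l : ℝ}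
    (hl : Tendsto (fun n : ℕ => (∑ i ∈ Finset.range n, ∑ j ∈ Finset.range n,
      v.selectedSqCov s e L L i j) / n) atTop (𝓝 l)) :
    Tendsto (fun n : ℕ => n * Var[fun ω => v.pathVar n L fun r => (D r ω, H r ω); μ]) atTop
      (𝓝 (v.step L * v.step L * l)) := by
  simpa only [covariance_self (h.memLp_pathVar v _ L).aemeasurable] using
    h.tendsto_mul_covariance_pathVar v hL hL hl

lemma tendsto_variance_sqrt_mul_pathVar_sub (h : IsInnovation D H s e μ) (v : Scheme)
    (hL : 0 < L) :
    Tendsto (fun n : ℕ => Var[fun ω => √n * v.pathVar n L (fun r => (D r ω, H r ω)) -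
      v.step L / √n * ∑ j ∈ Finset.range n, v.sqIncrement L j (fun r => (D r ω, H r ω)); μ])
      atTop (𝓝 0) := by
  have := h.isProbabilityMeasure
  have hbanded := v.isBandedPeriodic_selectedSqCov (s := s) (e := e) hL hL (v.step_pos hL)
    dvd_rfl dvd_rfl
  obtain ⟨l, hl⟩ := hbanded.exists_tendsto_sum_sum_div
  have hcount := v.tendsto_div_count hL
  have hlim := (h.tendsto_mul_covariance_pathVar v hL hL hl).add (hl.const_mul ((v.step L) ^ 2 : ℝ))
    |>.sub ((hcount.mul (hbanded.tendsto_sum_sum_sub_div hl L 0)).const_mul (2 * v.step L : ℝ))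
  convert hlim.congr' ?_ using 2
  · ring
  filter_upwards [eventually_gt_atTop 0] with n hn
  have hn0 : (0 : ℝ) < n := by exact_mod_cast hn
  rw [variance_const_mul_sub_const_mul (h.memLp_pathVar v n L) (h.memLp_sum_sqIncrement v L n),
    ← covariance_self (h.memLp_sum_sqIncrement v L n).aemeasurable,
    h.covariance_sum_sqIncrement v hL hL, covariance_self (h.memLp_pathVar v n L).aemeasurable,
    div_pow, Real.sq_sqrt hn0.le]
  simp only [Scheme.pathVar, covariance_const_mul_left, h.covariance_sum_sqIncrement v hL hL]
  field_simp
  simp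

end IsInnovation

end EmpiricalVariance

section PathVarianceLimits

namespace IsInnovation

variable {Ω : Type*} [MeasurableSpace Ω] {μ : Measure Ω} {D H : ℕ → Ω → ℝ} {s : ℝ≥0} {e : ℝ}
  {L L' : ℕ}

lemma memLp_pathVar_sub (h : IsInnovation D H s e μ) (v : Scheme) (L L' : ℕ) (a b : ℝ) (n : ℕ) :
    MemLp (fun ω => a * v.pathVar n L (fun r => (D r ω, H r ω)) -
      b * v.pathVar n L' (fun r => (D r ω, H r ω))) 2 μ :=
  ((h.memLp_pathVar v n L).const_mul a).sub ((h.memLp_pathVar v n L').const_mul b)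

lemma integral_pathVar_sub (h : IsInnovation D H s e μ) (v : Scheme) {n : ℕ} (hL : 0 < L)
    (hL' : 0 < L') (hn : L < n) (hn' : L' < n) (a b : ℝ) :
    ∫ ω, (a * v.pathVar n L (fun r => (D r ω, H r ω)) -
      b * v.pathVar n L' (fun r => (D r ω, H r ω))) ∂μ =
      a * (s * L + 2 * e) - b * (s * L' + 2 * e) := by
  have := h.isProbabilityMeasure
  rw [integral_sub (((h.memLp_pathVar v n L).const_mul a).integrable one_le_two)
    (((h.memLp_pathVar v n L').const_mul b).integrable one_le_two), integral_const_mul,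
    integral_const_mul, h.integral_pathVar v hL hn, h.integral_pathVar v hL' hn']

lemma eventually_integral_pathVar_sub (h : IsInnovation D H s e μ) (v : Scheme) (hL : 0 < L)
    (hL' : 0 < L') (a b : ℝ) :
    ∀ᶠ n in atTop, ∫ ω, (a * v.pathVar n L (fun r => (D r ω, H r ω)) -
      b * v.pathVar n L' (fun r => (D r ω, H r ω))) ∂μ =
      a * (s * L + 2 * e) - b * (s * L' + 2 * e) := by
  filter_upwards [eventually_gt_atTop L, eventually_gt_atTop L'] with n hn hn'
  exact h.integral_pathVar_sub v hL hL' hn hn' a b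

lemma tendstoInMeasure_pathVar_sub (h : IsInnovation D H s e μ) (v : Scheme) (hL : 0 < L)
    (hL' : 0 < L') (a b : ℝ) {γ : ℝ}
    (hγ : Tendsto (fun n : ℕ => n * Var[fun ω => a * v.pathVar n L (fun r => (D r ω, H r ω)) -
      b * v.pathVar n L' (fun r => (D r ω, H r ω)); μ]) atTop (𝓝 γ)) :
    TendstoInMeasure μ (fun n ω => a * v.pathVar n L (fun r => (D r ω, H r ω)) -
      b * v.pathVar n L' (fun r => (D r ω, H r ω))) atTop
      fun _ => a * (s * L + 2 * e) - b * (s * L' + 2 * e) := by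
  have := h.isProbabilityMeasure
  have hvar : Tendsto (fun n : ℕ => Var[fun ω => a * v.pathVar n L (fun r => (D r ω, H r ω)) -
      b * v.pathVar n L' (fun r => (D r ω, H r ω)); μ]) atTop (𝓝 0) := by
    have hlim := tendsto_inv_atTop_nhds_zero_nat (𝕜 := ℝ) |>.mul hγ
    rw [zero_mul] at hlim
    refine hlim.congr' ?_
    filter_upwards [eventually_gt_atTop 0] with n hn
    exact inv_mul_cancel_left₀ (by exact_mod_cast hn.ne') _
  have hcentered := tendstoInMeasure_sub_integral_of_variance (h.memLp_pathVar_sub v L L' a b) hvar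
  rw [tendstoInMeasure_iff_norm] at hcentered ⊢
  refine fun ε hε => (hcentered ε hε).congr' ?_
  filter_upwards [h.eventually_integral_pathVar_sub v hL hL' a b] with n hn
  simp only [hn, sub_zero]

lemma tendsto_variance_sum_sqIncrement_sub_div (h : IsInnovation D H s e μ) (v : Scheme)
    (hL : 0 < L) (hL' : 0 < L') (a b : ℝ) {γ : ℝ}
    (hγ : Tendsto (fun n : ℕ => n * Var[fun ω => a * v.pathVar n L (fun r => (D r ω, H r ω)) -
      b * v.pathVar n L' (fun r => (D r ω, H r ω)); μ]) atTop (𝓝 γ)) :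
    Tendsto (fun n : ℕ => Var[fun ω => ∑ j ∈ Finset.range n,
      (a * v.step L * v.sqIncrement L j (fun r => (D r ω, H r ω)) -
        b * v.step L' * v.sqIncrement L' j (fun r => (D r ω, H r ω))); μ] / n) atTop (𝓝 γ) := by
  have := h.isProbabilityMeasure
  have hstep := v.step_pos hL
  have hstep' := v.step_pos hL'
  obtain ⟨l, hl⟩ := (v.isBandedPeriodic_selectedSqCov (s := s) (e := e) hL hL hstep dvd_rfl
    dvd_rfl).exists_tendsto_sum_sum_div
  obtain ⟨l', hl'⟩ := (v.isBandedPeriodic_selectedSqCov (s := s) (e := e) hL' hL' hstep' dvd_rfl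
    dvd_rfl).exists_tendsto_sum_sum_div
  obtain ⟨d, hd⟩ := (v.isBandedPeriodic_selectedSqCov (s := s) (e := e) hL hL'
    (Nat.mul_pos hstep hstep') (Nat.dvd_mul_right _ _)
    (Nat.dvd_mul_left _ _)).exists_tendsto_sum_sum_div
  rw [tendsto_nhds_unique hγ (tendsto_mul_variance_const_mul_sub_const_mul
    (h.memLp_pathVar v · L) (h.memLp_pathVar v · L') (h.tendsto_mul_variance_pathVar v hL hl)
    (h.tendsto_mul_variance_pathVar v hL' hl') (h.tendsto_mul_covariance_pathVar v hL hL' hd) a b)]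
  simp only [← h.covariance_sum_sqIncrement v hL hL', ← h.covariance_sum_sqIncrement v hL hL,
    ← h.covariance_sum_sqIncrement v hL' hL', div_eq_inv_mul,
    covariance_self (h.memLp_sum_sqIncrement v _ _).aemeasurable] at hl hl' hd
  convert tendsto_mul_variance_const_mul_sub_const_mul (h.memLp_sum_sqIncrement v L)
    (h.memLp_sum_sqIncrement v L') hl hl' hd (a * v.step L) (b * v.step L') using 2
  · simp only [Finset.sum_sub_distrib, Finset.mul_sum, div_eq_inv_mul]
  · ring

lemma tendsto_variance_sqrt_mul_pathVar_sub_sub (h : IsInnovation D H s e μ) (v : Scheme)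
    (hL : 0 < L) (hL' : 0 < L') (a b : ℝ) :
    Tendsto (fun n : ℕ => Var[fun ω => √n * (a * v.pathVar n L (fun r => (D r ω, H r ω)) -
        b * v.pathVar n L' (fun r => (D r ω, H r ω))) - (√n)⁻¹ * ∑ j ∈ Finset.range n,
      (a * v.step L * v.sqIncrement L j (fun r => (D r ω, H r ω)) -
        b * v.step L' * v.sqIncrement L' j (fun r => (D r ω, H r ω))); μ]) atTop (𝓝 0) := by
  have := h.isProbabilityMeasure
  have hmem : ∀ L (n : ℕ), MemLp (fun ω => √n * v.pathVar n L (fun r => (D r ω, H r ω)) -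
      v.step L / √n * ∑ j ∈ Finset.range n, v.sqIncrement L j (fun r => (D r ω, H r ω))) 2 μ :=
    fun L n => ((h.memLp_pathVar v n L).const_mul _).sub
      ((h.memLp_sum_sqIncrement v L n).const_mul _)
  have hbound := ((h.tendsto_variance_sqrt_mul_pathVar_sub v hL).const_mul (2 * a ^ 2)).add
    ((h.tendsto_variance_sqrt_mul_pathVar_sub v hL').const_mul (2 * b ^ 2))
  rw [mul_zero, mul_zero, add_zero] at hbound
  refine squeeze_zero (fun n => variance_nonneg _ _) (fun n => ?_) hbound
  convert variance_const_mul_sub_const_mul_le (hmem L n) (hmem L' n) a b using 3 with ω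
  simp only [Finset.sum_sub_distrib, ← Finset.mul_sum]
  ring

theorem tendstoInDistribution_sqrt_mul_pathVar_sub [IsProbabilityMeasure μ]
    (h : IsInnovation D H s e μ) (v : Scheme) (hL : 0 < L) (hL' : 0 < L') (a b : ℝ) {γ : ℝ}
    (hγ : Tendsto (fun n : ℕ => n * Var[fun ω => a * v.pathVar n L (fun r => (D r ω, H r ω)) -
      b * v.pathVar n L' (fun r => (D r ω, H r ω)); μ]) atTop (𝓝 γ)) :
    TendstoInDistribution (fun (n : ℕ) ω => √n *
      (a * v.pathVar n L (fun r => (D r ω, H r ω)) - b * v.pathVar n L' (fun r => (D r ω, H r ω)) -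
        (a * (s * L + 2 * e) - b * (s * L' + 2 * e)))) atTop (id : ℝ → ℝ) (fun _ => μ)
      (gaussianReal 0 γ.toNNReal) := by
  have hstep := Nat.mul_pos (v.step_pos hL) (v.step_pos hL')
  have hlocal := (v.isPeriodicLocal_sqIncrement hstep (Nat.dvd_mul_right _ _)
    (le_max_left L L')).const_mul_sub_const_mul (v.isPeriodicLocal_sqIncrement hstep
      (Nat.dvd_mul_left _ _) (le_max_right L L')) (a * v.step L) (b * v.step L')
  have hmem : ∀ j, MemLp (fun ω => a * v.step L * v.sqIncrement L j (fun r => (D r ω, H r ω)) -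
      b * v.step L' * v.sqIncrement L' j (fun r => (D r ω, H r ω))) 2 μ := fun j =>
    ((h.memLp_sqIncrement v L j).const_mul _).sub ((h.memLp_sqIncrement v L' j).const_mul _)
  have hclt := hlocal.tendstoInDistribution_inv_sqrt_mul_sum h.iIndepFun_prodMk
    h.identDistrib_prodMk hmem (h.tendsto_variance_sum_sqIncrement_sub_div v hL hL' a b hγ)
  have hpath := h.memLp_pathVar_sub v L L' a b
  have hsum : ∀ n, MemLp (fun ω => ∑ j ∈ Finset.range n,
      (a * v.step L * v.sqIncrement L j (fun r => (D r ω, H r ω)) -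
        b * v.step L' * v.sqIncrement L' j (fun r => (D r ω, H r ω)))) 2 μ :=
    fun n => memLp_finsetSum _ fun j _ => hmem j
  refine tendstoInDistribution_of_tendstoInMeasure_sub _ _ hclt
    ((tendstoInMeasure_sub_integral_of_variance
      (fun n => ((hpath n).const_mul √n).sub ((hsum n).const_mul (√n)⁻¹))
      (h.tendsto_variance_sqrt_mul_pathVar_sub_sub v hL hL' a b)).congr' ?_ EventuallyEq.rfl)
    fun n => ((hpath n).sub (memLp_const _)).aestronglyMeasurable.aemeasurable.const_mul _
  filter_upwards [h.eventually_integral_pathVar_sub v hL hL' a b] with n hn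
  refine ae_of_all _ fun ω => ?_
  simp only [Pi.sub_apply]
  rw [integral_sub (((hpath n).const_mul √n).integrable one_le_two)
    (((hsum n).const_mul (√n)⁻¹).integrable one_le_two), integral_const_mul, integral_const_mul, hn,
    integral_finsetSum _ fun j _ => (hmem j).integrable one_le_two]
  simp only [Finset.sum_sub_distrib]
  ring

lemma ae_tendsto_pathVar_disjoint (h : IsInnovation D H s e μ) (hL : 0 < L) :
    ∀ᵐ ω ∂μ, Tendsto (fun n => Scheme.disjoint.pathVar n L fun r => (D r ω, H r ω)) atTop
      (𝓝 (s * L + 2 * e)) := by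
  have := h.isProbabilityMeasure
  have hmeas : Measurable fun z => windowIncrement L 0 z ^ 2 :=
    (measurable_windowIncrement L 0).pow_const 2
  have hshift : ∀ q ω, windowIncrement L (q * (L + 1)) (fun r => (D r ω, H r ω)) ^ 2 =
      windowIncrement L 0 (fun r => (D (q * (L + 1) + r) ω, H (q * (L + 1) + r) ω)) ^ 2 :=
    fun q ω => by simpa only [zero_add] using congrArg (· ^ 2) (windowIncrement_add L 0 _ _)
  have hindep : iIndepFun
      (fun q ω => windowIncrement L (q * (L + 1)) (fun r => (D r ω, H r ω)) ^ 2) μ := by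
    simp only [hshift]
    refine iIndepFun_block (fun j => (h.aemeasurable_diffusion j).prodMk (h.aemeasurable_noise j))
      h.iIndepFun_prodMk L.succ_pos hmeas fun z z' hz => ?_
    rw [windowIncrement_congr fun r hr => hz _ (by omega)]
  have hident : ∀ q, IdentDistrib
      (fun ω => windowIncrement L (q * (L + 1)) (fun r => (D r ω, H r ω)) ^ 2)
      (fun ω => windowIncrement L (0 * (L + 1)) (fun r => (D r ω, H r ω)) ^ 2) μ μ := by
    simp only [hshift]
    exact fun q => (identDistrib_shift h.iIndepFun_prodMk h.identDistrib_prodMk hmeas _).trans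
      (identDistrib_shift h.iIndepFun_prodMk h.identDistrib_prodMk hmeas _).symm
  have hlln := strong_law_ae_real _
    (memLp_two_sq (h.memLp_windowIncrement L _) |>.integrable one_le_two)
    (fun i j hij => hindep.indepFun hij) hident
  rw [h.integral_windowIncrement_sq hL] at hlln
  filter_upwards [hlln] with ω hω
  refine (hω.comp (Nat.tendsto_div_const_atTop L.succ_ne_zero)).congr fun n => ?_
  rw [Scheme.disjoint.pathVar_eq hL, ← div_eq_inv_mul]
  simp only [Scheme.start_eq]
  rfl

end IsInnovation

end PathVarianceLimits

section Market

variable {Ω : Type*}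

/-- The increment of the mid price over the interval `[j τ, (j + 1) τ]`. -/
def midIncrement (pStar : ℝ≥0 → Ω → ℝ) (τ : ℝ≥0) (j : ℕ) (ω : Ω) : ℝ :=
  pStar ((j + 1 : ℕ) * τ) ω - pStar (j * τ) ω

lemma logPrice_sub (S : ℝ) (pStar X : ℝ≥0 → Ω → ℝ) (τ : ℝ≥0) (L j : ℕ) (ω : Ω) :
    logPrice S pStar X ((j + L : ℕ) * τ) ω - logPrice S pStar X (j * τ) ω =
      windowIncrement L j fun r => (midIncrement pStar τ r ω, noise S X (r * τ) ω) := by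
  have htelescope := Finset.sum_Ico_sub (fun r : ℕ => pStar (r * τ) ω) (Nat.le_add_right j L)
  simp only [windowIncrement, logPrice, midIncrement, htelescope]
  ring

lemma empVar_logPrice (S : ℝ) (pStar X : ℝ≥0 → Ω → ℝ) (τ : ℝ≥0) (v : Scheme) {L : ℕ} (hL : 0 < L)
    (n : ℕ) :
    empVar (logPrice S pStar X) τ v n L = fun ω =>
      v.pathVar n L fun r => (midIncrement pStar τ r ω, noise S X (r * τ) ω) := by
  ext ω
  simp only [empVar, logPrice_sub, v.pathVar_eq hL, one_div]

lemma spreadEstimator_eq (p : ℝ≥0 → Ω → ℝ) (τ : ℝ≥0) (v : Scheme) (L L' n : ℕ) :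
    spreadEstimator p τ v L L' n = fun ω =>
      2 * L' / ((L' : ℝ) - L) * empVar p τ v n L ω -
        2 * L / ((L' : ℝ) - L) * empVar p τ v n L' ω := by
  ext ω
  rw [spreadEstimator]
  ring

lemma spread_combination (s S : ℝ) {L L' : ℕ} (h : L ≠ L') :
    2 * L' / ((L' : ℝ) - L) * (s * L + 2 * (S ^ 2 / 4)) -
      2 * L / ((L' : ℝ) - L) * (s * L' + 2 * (S ^ 2 / 4)) = S ^ 2 := by
  have hLr : (L' : ℝ) - L ≠ 0 := sub_ne_zero.2 (by exact_mod_cast h.symm)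
  field_simp
  ring

lemma sigmaSq_pos {σ : ℝ} (hσ : 0 < σ) (S : ℝ) {τ : ℝ≥0} (hτ : 0 < τ) (v : Scheme) {L : ℕ}
    (hL : 0 < L) : 0 < sigmaSq σ S τ v L := by
  cases v <;> simp only [sigmaSq] <;> positivity

lemma Scheme.zeta_pos (v : Scheme) {L : ℕ} (hL : 0 < L) : 0 < v.zeta L := by
  rw [v.zeta_eq]
  exact_mod_cast v.step_pos hL

lemma asympVar_div_sqrt {σ : ℝ} (hσ : 0 < σ) (S : ℝ) {τ : ℝ≥0} (hτ : 0 < τ) (v : Scheme)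
    {L L' : ℕ} (hL : 0 < L) (hL' : 0 < L') (c : ℝ) :
    asympVar σ S τ v L L'
        (c / (√(v.zeta L * sigmaSq σ S τ v L) * √(v.zeta L' * sigmaSq σ S τ v L'))) =
      (2 * L' / ((L' : ℝ) - L)) ^ 2 * (v.zeta L * sigmaSq σ S τ v L) +
        (2 * L / ((L' : ℝ) - L)) ^ 2 * (v.zeta L' * sigmaSq σ S τ v L') -
        2 * (2 * L' / ((L' : ℝ) - L) * (2 * L / ((L' : ℝ) - L))) * c := by
  have hζ := v.zeta_pos hL
  have hζ' := v.zeta_pos hL'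
  have hsigma := Real.sqrt_pos.2 (sigmaSq_pos hσ S hτ v hL)
  have hsigma' := Real.sqrt_pos.2 (sigmaSq_pos hσ S hτ v hL')
  have _hsqrt := Real.sqrt_pos.2 hζ
  have _hsqrt' := Real.sqrt_pos.2 hζ'
  rw [asympVar, Real.sqrt_mul hζ.le, Real.sqrt_mul hζ.le, Real.sqrt_mul hζ'.le]
  field_simp
  norm_num

lemma midIncrement_eq {σ : ℝ} (hσ : 0 < σ) (pStar : ℝ≥0 → Ω → ℝ) (τ : ℝ≥0) (j : ℕ) :
    midIncrement pStar τ j = fun ω => σ * ((pStar ((j + 1 : ℕ) * τ) ω - pStar 0 ω) / σ -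
      (pStar (j * τ) ω - pStar 0 ω) / σ) := by
  ext ω
  rw [midIncrement]
  field_simp
  ring

namespace MarketModel

variable [MeasurableSpace Ω] {μ : Measure Ω} {pStar X : ℝ≥0 → Ω → ℝ} {σ S : ℝ} {τ : ℝ≥0}
  {L L' : ℕ}

lemma hasLaw_noise (h : MarketModel μ pStar X σ S) (t : ℝ≥0) :
    HasLaw (noise S X t) (bernoulliHalf.map fun x => S * (x - 1 / 2)) μ :=
  HasLaw.comp (Y := fun x : ℝ => S * (x - 1 / 2)) ⟨by fun_prop, rfl⟩ (h.direction_law t)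

lemma integral_noise (h : MarketModel μ pStar X σ S) (t : ℝ≥0) : ∫ ω, noise S X t ω ∂μ = 0 := by
  refine ((h.direction_law t).integral_comp (f := fun x => S * (x - 1 / 2)) (by fun_prop)).trans ?_
  rw [bernoulliHalf, integral_bernoulliMeasure]
  norm_num

lemma noise_sq_ae_eq (h : MarketModel μ pStar X σ S) (t : ℝ≥0) :
    ∀ᵐ ω ∂μ, noise S X t ω ^ 2 = S ^ 2 / 4 := by
  have hbernoulli : ∀ᵐ x ∂bernoulliHalf, (S * (x - 1 / 2)) ^ 2 = S ^ 2 / 4 := by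
    rw [bernoulliHalf, bernoulliMeasure_def, ae_add_measure_iff]
    constructor <;> refine Measure.ae_smul_measure ?_ _ <;> rw [ae_dirac_eq, eventually_pure] <;>
      ring
  rw [← (h.direction_law t).map_eq] at hbernoulli
  exact ae_of_ae_map (h.direction_law t).aemeasurable hbernoulli

lemma hasLaw_midIncrement (h : MarketModel μ pStar X σ S) (hσ : 0 < σ) (τ : ℝ≥0) (j : ℕ) :
    HasLaw (midIncrement pStar τ j) (gaussianReal 0 (.mk (σ ^ 2) (sq_nonneg σ) * τ)) μ := by
  have hlaw := gaussianReal_const_mul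
    (h.brownian.isBrownianReal.toIsPreBrownianReal.hasLaw_sub ((j + 1 : ℕ) * τ) (j * τ)) σ
  have hdist : nndist ((j + 1 : ℕ) * τ).1 (j * τ).1 = τ := by
    ext
    simp [add_mul]
  rw [midIncrement_eq hσ]
  simpa only [mul_zero, hdist, Pi.sub_apply] using hlaw

lemma iIndepFun_midIncrement (h : MarketModel μ pStar X σ S) (hσ : 0 < σ) (τ : ℝ≥0) :
    iIndepFun (midIncrement pStar τ) μ := by
  have hmono : Monotone fun j : ℕ => (j : ℝ≥0) * τ := fun i j hij => by dsimp only; gcongr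
  have hindep := (h.brownian.isBrownianReal.toIsPreBrownianReal.hasIndepIncrements.nat hmono).comp
    (fun _ x => σ * x) fun _ => by fun_prop
  rwa [funext (midIncrement_eq hσ pStar τ)]

lemma isInnovation (h : MarketModel μ pStar X σ S) (hσ : 0 < σ) (hτ : 0 < τ) :
    IsInnovation (midIncrement pStar τ) (fun j => noise S X (j * τ)) (.mk (σ ^ 2) (sq_nonneg σ) * τ)
      (S ^ 2 / 4) μ where
  diffusion_law := h.hasLaw_midIncrement hσ τ
  diffusion_indep := h.iIndepFun_midIncrement hσ τ
  noise_identDistrib j := (h.hasLaw_noise _).identDistrib (h.hasLaw_noise _)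
  noise_indep := h.noise_indep.precomp fun i j hij => by simpa [hτ.ne'] using hij
  noise_mean j := h.integral_noise _
  noise_sq j := h.noise_sq_ae_eq _
  indep := h.mid_indep_noise.comp
    (φ := fun (x : ℝ≥0 → ℝ) (j : ℕ) => x ((j + 1 : ℕ) * τ) - x (j * τ))
    (ψ := fun (x : ℝ≥0 → ℝ) (j : ℕ) => x (j * τ)) (by fun_prop) (by fun_prop)

lemma memLp_empVar (h : MarketModel μ pStar X σ S) (hσ : 0 < σ) (hτ : 0 < τ) (v : Scheme)
    (hL : 0 < L) (n : ℕ) : MemLp (empVar (logPrice S pStar X) τ v n L) 2 μ := by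
  rw [empVar_logPrice S pStar X τ v hL]
  exact (h.isInnovation hσ hτ).memLp_pathVar v n L

lemma integrable_spreadEstimator (h : MarketModel μ pStar X σ S) (hσ : 0 < σ) (hτ : 0 < τ)
    (v : Scheme) (hL : 0 < L) (hL' : 0 < L') (n : ℕ) :
    Integrable (spreadEstimator (logPrice S pStar X) τ v L L' n) μ := by
  have := (h.isInnovation hσ hτ).isProbabilityMeasure
  rw [spreadEstimator_eq]
  exact (((h.memLp_empVar hσ hτ v hL n).integrable one_le_two).const_mul _).sub
    (((h.memLp_empVar hσ hτ v hL' n).integrable one_le_two).const_mul _)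

lemma integral_spreadEstimator (h : MarketModel μ pStar X σ S) (hσ : 0 < σ) (hτ : 0 < τ)
    (v : Scheme) (hL : 0 < L) (hL' : 0 < L') (hLL' : L ≠ L') {n : ℕ} (hn : L < n) (hn' : L' < n) :
    ∫ ω, spreadEstimator (logPrice S pStar X) τ v L L' n ω ∂μ = S ^ 2 := by
  simp only [spreadEstimator_eq, empVar_logPrice S pStar X τ v hL,
    empVar_logPrice S pStar X τ v hL']
  rw [(h.isInnovation hσ hτ).integral_pathVar_sub v hL hL' hn hn', spread_combination _ _ hLL']

lemma tendsto_mul_variance_empVar (h : MarketModel μ pStar X σ S) (hσ : 0 < σ) (hτ : 0 < τ)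
    (v : Scheme) (hL : 0 < L) :
    Tendsto (fun n : ℕ => n * Var[empVar (logPrice S pStar X) τ v n L; μ]) atTop
      (𝓝 (v.zeta L * sigmaSq σ S τ v L)) := by
  have hstep : (v.step L : ℝ) ≠ 0 := by exact_mod_cast (v.step_pos hL).ne'
  have hlim := (h.isInnovation hσ hτ).tendsto_mul_variance_pathVar v hL
    (v.tendsto_sum_sum_selectedSqCov_self_div σ S τ hL)
  rw [mul_assoc, mul_div_cancel₀ _ hstep, ← v.zeta_eq] at hlim
  simpa only [empVar_logPrice S pStar X τ v hL] using hlim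

lemma tendsto_mul_covariance_empVar (h : MarketModel μ pStar X σ S) (hσ : 0 < σ) (hτ : 0 < τ)
    (v : Scheme) (hL : 0 < L) (hL' : 0 < L') {l : ℝ}
    (hl : Tendsto (fun n : ℕ => (∑ i ∈ Finset.range n, ∑ j ∈ Finset.range n,
      v.selectedSqCov (σ ^ 2 * τ) (S ^ 2 / 4) L L' i j) / n) atTop (𝓝 l)) :
    Tendsto (fun n : ℕ => n * cov[empVar (logPrice S pStar X) τ v n L,
      empVar (logPrice S pStar X) τ v n L'; μ]) atTop (𝓝 (v.zeta L * v.zeta L' * l)) := by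
  simpa only [empVar_logPrice S pStar X τ v hL, empVar_logPrice S pStar X τ v hL', v.zeta_eq] using
    (h.isInnovation hσ hτ).tendsto_mul_covariance_pathVar v hL hL' hl

lemma exists_tendsto_mul_covariance_empVar (h : MarketModel μ pStar X σ S) (hσ : 0 < σ)
    (hτ : 0 < τ) (v : Scheme) (hL : 0 < L) (hL' : 0 < L') :
    ∃ c, Tendsto (fun n : ℕ => n * cov[empVar (logPrice S pStar X) τ v n L,
      empVar (logPrice S pStar X) τ v n L'; μ]) atTop (𝓝 c) := by
  obtain ⟨l, hl⟩ := (v.isBandedPeriodic_selectedSqCov (s := σ ^ 2 * τ) (e := S ^ 2 / 4) hL hL'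
    (Nat.mul_pos (v.step_pos hL) (v.step_pos hL')) (Nat.dvd_mul_right _ _)
    (Nat.dvd_mul_left _ _)).exists_tendsto_sum_sum_div
  exact ⟨_, h.tendsto_mul_covariance_empVar hσ hτ v hL hL' hl⟩

lemma tendsto_corr_empVar (h : MarketModel μ pStar X σ S) (hσ : 0 < σ) (hτ : 0 < τ) (v : Scheme)
    (hL : 0 < L) (hL' : 0 < L') {c : ℝ}
    (hc : Tendsto (fun n : ℕ => n * cov[empVar (logPrice S pStar X) τ v n L,
      empVar (logPrice S pStar X) τ v n L'; μ]) atTop (𝓝 c)) :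
    Tendsto (fun n => corr μ (empVar (logPrice S pStar X) τ v n L)
        (empVar (logPrice S pStar X) τ v n L')) atTop
      (𝓝 (c / (√(v.zeta L * sigmaSq σ S τ v L) * √(v.zeta L' * sigmaSq σ S τ v L')))) :=
  tendsto_corr_of_tendsto_natCast_mul (mul_pos (v.zeta_pos hL) (sigmaSq_pos hσ S hτ v hL))
    (mul_pos (v.zeta_pos hL') (sigmaSq_pos hσ S hτ v hL'))
    (h.tendsto_mul_variance_empVar hσ hτ v hL) (h.tendsto_mul_variance_empVar hσ hτ v hL') hc

lemma exists_tendsto_corr_empVar (h : MarketModel μ pStar X σ S) (hσ : 0 < σ) (hτ : 0 < τ)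
    (v : Scheme) (hL : 0 < L) (hL' : 0 < L') :
    ∃ r, Tendsto (fun n => corr μ (empVar (logPrice S pStar X) τ v n L)
      (empVar (logPrice S pStar X) τ v n L')) atTop (𝓝 r) := by
  obtain ⟨c, hc⟩ := h.exists_tendsto_mul_covariance_empVar hσ hτ v hL hL'
  exact ⟨_, h.tendsto_corr_empVar hσ hτ v hL hL' hc⟩

variable {v : Scheme} {r : ℝ}

lemma tendsto_mul_variance_spreadEstimator (h : MarketModel μ pStar X σ S) (hσ : 0 < σ)
    (hτ : 0 < τ) (hL : 0 < L) (hL' : 0 < L')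
    (hr : Tendsto (fun n => corr μ (empVar (logPrice S pStar X) τ v n L)
      (empVar (logPrice S pStar X) τ v n L')) atTop (𝓝 r)) :
    Tendsto (fun n : ℕ => n * Var[spreadEstimator (logPrice S pStar X) τ v L L' n; μ]) atTop
      (𝓝 (asympVar σ S τ v L L' r)) := by
  have := (h.isInnovation hσ hτ).isProbabilityMeasure
  obtain ⟨c, hc⟩ := h.exists_tendsto_mul_covariance_empVar hσ hτ v hL hL'
  rw [tendsto_nhds_unique hr (h.tendsto_corr_empVar hσ hτ v hL hL' hc),
    asympVar_div_sqrt hσ S hτ v hL hL']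
  simp only [spreadEstimator_eq]
  exact tendsto_mul_variance_const_mul_sub_const_mul (h.memLp_empVar hσ hτ v hL)
    (h.memLp_empVar hσ hτ v hL') (h.tendsto_mul_variance_empVar hσ hτ v hL)
    (h.tendsto_mul_variance_empVar hσ hτ v hL') hc _ _

lemma asympVar_nonneg (h : MarketModel μ pStar X σ S) (hσ : 0 < σ)
    (hτ : 0 < τ) (hL : 0 < L) (hL' : 0 < L')
    (hr : Tendsto (fun n => corr μ (empVar (logPrice S pStar X) τ v n L)
      (empVar (logPrice S pStar X) τ v n L')) atTop (𝓝 r)) :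
    0 ≤ asympVar σ S τ v L L' r :=
  ge_of_tendsto' (h.tendsto_mul_variance_spreadEstimator hσ hτ hL hL' hr) fun n =>
    mul_nonneg n.cast_nonneg (variance_nonneg _ _)

lemma tendstoInMeasure_spreadEstimator (h : MarketModel μ pStar X σ S) (hσ : 0 < σ) (hτ : 0 < τ)
    (v : Scheme) (hL : 0 < L) (hL' : 0 < L') (hLL' : L ≠ L') :
    TendstoInMeasure μ (spreadEstimator (logPrice S pStar X) τ v L L') atTop fun _ => S ^ 2 := by
  obtain ⟨r, hr⟩ := h.exists_tendsto_corr_empVar hσ hτ v hL hL'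
  have hvar := h.tendsto_mul_variance_spreadEstimator hσ hτ hL hL' hr
  simp only [spreadEstimator_eq, empVar_logPrice S pStar X τ v hL,
    empVar_logPrice S pStar X τ v hL'] at hvar
  have hlim := (h.isInnovation hσ hτ).tendstoInMeasure_pathVar_sub v hL hL' _ _ hvar
  rw [spread_combination _ _ hLL'] at hlim
  convert hlim using 2 with n
  rw [spreadEstimator_eq, empVar_logPrice S pStar X τ v hL, empVar_logPrice S pStar X τ v hL']

lemma ae_tendsto_spreadEstimator_disjoint (h : MarketModel μ pStar X σ S) (hσ : 0 < σ)
    (hτ : 0 < τ) (hL : 0 < L) (hL' : 0 < L') (hLL' : L ≠ L') :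
    ∀ᵐ ω ∂μ, Tendsto (fun n => spreadEstimator (logPrice S pStar X) τ .disjoint L L' n ω) atTop
      (𝓝 (S ^ 2)) := by
  filter_upwards [(h.isInnovation hσ hτ).ae_tendsto_pathVar_disjoint hL,
    (h.isInnovation hσ hτ).ae_tendsto_pathVar_disjoint hL'] with ω hω hω'
  have hlim := (hω.const_mul (2 * L' / ((L' : ℝ) - L))).sub
    (hω'.const_mul (2 * L / ((L' : ℝ) - L)))
  rw [spread_combination _ _ hLL'] at hlim
  simpa only [spreadEstimator_eq, empVar_logPrice S pStar X τ .disjoint hL,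
    empVar_logPrice S pStar X τ .disjoint hL'] using hlim

lemma tendstoInDistribution_spreadEstimator [IsProbabilityMeasure μ]
    (h : MarketModel μ pStar X σ S) (hσ : 0 < σ)
    (hτ : 0 < τ) (hL : 0 < L) (hL' : 0 < L') (hLL' : L ≠ L')
    (hr : Tendsto (fun n => corr μ (empVar (logPrice S pStar X) τ v n L)
      (empVar (logPrice S pStar X) τ v n L')) atTop (𝓝 r)) :
    TendstoInDistribution (fun (n : ℕ) ω =>
        √n * (spreadEstimator (logPrice S pStar X) τ v L L' n ω - S ^ 2))
      atTop (id : ℝ → ℝ) (fun _ => μ) (gaussianReal 0 (asympVar σ S τ v L L' r).toNNReal) := by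
  have hvar := h.tendsto_mul_variance_spreadEstimator hσ hτ hL hL' hr
  simp only [spreadEstimator_eq, empVar_logPrice S pStar X τ v hL,
    empVar_logPrice S pStar X τ v hL'] at hvar ⊢
  have hlim := (h.isInnovation hσ hτ).tendstoInDistribution_sqrt_mul_pathVar_sub v hL hL' _ _ hvar
  rwa [spread_combination _ _ hLL'] at hlim

lemma incrementVar_logPrice (h : MarketModel μ pStar X σ S) (hσ : 0 < σ) (hτ : 0 < τ)
    (hL : 0 < L) :
    incrementVar (logPrice S pStar X) μ (L * τ) = σ ^ 2 * τ * L + S ^ 2 / 2 := by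
  have hvar := (h.isInnovation hσ hτ).variance_windowIncrement hL 0
  simp only [← logPrice_sub, Nat.cast_zero, zero_mul, zero_add, NNReal.coe_mul,
    NNReal.coe_mk] at hvar
  rw [incrementVar, hvar]
  ring

lemma incrementMoment_logPrice (h : MarketModel μ pStar X σ S) (hσ : 0 < σ) (hτ : 0 < τ)
    (hL : 0 < L) :
    incrementMoment (logPrice S pStar X) μ (L * τ) (L * τ) =
      (σ ^ 2 * τ * L + S ^ 2 / 2) ^ 2 + sigmaSq σ S τ .disjoint L := by
  have hinn := h.isInnovation hσ hτ
  have := hinn.isProbabilityMeasure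
  have hmem := memLp_two_sq (hinn.memLp_windowIncrement L 0)
  have hcov := covariance_eq_sub hmem hmem
  rw [hinn.covariance_windowIncrement_sq hL hL, hinn.integral_windowIncrement_sq hL, sqCov_self]
    at hcov
  have hend : (2 * (L * τ : ℝ≥0) - L * τ : ℝ).toNNReal = L * τ := by
    rw [NNReal.coe_mul, NNReal.coe_natCast, two_mul, add_sub_cancel_right,
      ← NNReal.coe_natCast, ← NNReal.coe_mul, Real.toNNReal_coe]
  have hstart : ((L * τ : ℝ≥0) - L * τ : ℝ).toNNReal = 0 := by simp
  simp only [Pi.mul_apply, ← logPrice_sub, Nat.cast_zero, zero_mul, zero_add, NNReal.coe_mul,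
    NNReal.coe_mk] at hcov
  rw [incrementMoment, hend, hstart]
  simp only [sigmaSq]
  linear_combination -hcov

lemma asympVar_eq_explicitVar (h : MarketModel μ pStar X σ S) (hσ : 0 < σ) (hτ : 0 < τ)
    (hL : 0 < L) (hL' : 0 < L') {m : ℕ} (hm : 2 ≤ m) (hLm : L' + 1 = m * (L + 1))
    (hr : Tendsto (fun n => corr μ (empVar (logPrice S pStar X) τ .disjoint n L)
      (empVar (logPrice S pStar X) τ .disjoint n L')) atTop (𝓝 r)) :
    asympVar σ S τ .disjoint L L' r = explicitVar (logPrice S pStar X) μ S τ L L' := by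
  have hcov := h.tendsto_mul_covariance_empVar hσ hτ .disjoint hL hL'
    (tendsto_sum_sum_selectedSqCov_disjoint_div hL hm hLm)
  have hratio : (m : ℝ) = ((L' : ℝ) + 1) / (L + 1) := by
    rw [eq_div_iff (by positivity)]
    exact_mod_cast hLm.symm
  rw [tendsto_nhds_unique hr (h.tendsto_corr_empVar hσ hτ .disjoint hL hL' hcov),
    asympVar_div_sqrt hσ S hτ .disjoint hL hL', hratio]
  simp only [explicitVar, h.incrementVar_logPrice hσ hτ hL, h.incrementVar_logPrice hσ hτ hL',
    h.incrementMoment_logPrice hσ hτ hL, h.incrementMoment_logPrice hσ hτ hL', sigmaSq,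
    Scheme.zeta]
  field_simp
  ring

end MarketModel

end Market

end BidAskSpread

theorem mainTheorem1 {Ω : Type*} [MeasurableSpace Ω] (μ : Measure Ω) [IsProbabilityMeasure μ]
    (pStar X : ℝ≥0 → Ω → ℝ) (σ S : ℝ) (hσ : 0 < σ)
    (hModel : BidAskSpread.MarketModel μ pStar X σ S)
    (τ : ℝ≥0) (hτ : 0 < τ) (v : BidAskSpread.Scheme)
    (L L' : ℕ) (hL : 1 ≤ L) (hL' : 1 ≤ L') (hLL' : L ≠ L') :
    -- unbiasedness
    (∀ n : ℕ, L < n → L' < n →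
      Integrable (BidAskSpread.spreadEstimator (BidAskSpread.logPrice S pStar X) τ v L L' n) μ ∧
      ∫ ω, BidAskSpread.spreadEstimator (BidAskSpread.logPrice S pStar X) τ v L L' n ω ∂μ = S ^ 2) ∧
    -- consistency
    TendstoInMeasure μ
      (fun n => BidAskSpread.spreadEstimator (BidAskSpread.logPrice S pStar X) τ v L L' n)
      atTop (fun _ => S ^ 2) ∧
    -- strong consistency for strictly disjoint increments
    (v = BidAskSpread.Scheme.disjoint →
      ∀ᵐ ω ∂μ, Tendsto
        (fun n => BidAskSpread.spreadEstimator (BidAskSpread.logPrice S pStar X) τ v L L' n ω)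
        atTop (𝓝 (S ^ 2))) ∧
    -- existence of the limit correlation, and asymptotic normality
    ∃ r : ℝ,
      Tendsto (fun n => BidAskSpread.corr μ
          (BidAskSpread.empVar (BidAskSpread.logPrice S pStar X) τ v n L)
          (BidAskSpread.empVar (BidAskSpread.logPrice S pStar X) τ v n L'))
        atTop (𝓝 r) ∧
      0 ≤ BidAskSpread.asympVar σ S τ v L L' r ∧
      TendstoInDistribution
        (fun (n : ℕ) (ω : Ω) => √(n : ℝ) *
          (BidAskSpread.spreadEstimator (BidAskSpread.logPrice S pStar X) τ v L L' n ω - S ^ 2))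
        atTop (id : ℝ → ℝ) (fun _ => μ)
        (gaussianReal 0 (BidAskSpread.asympVar σ S τ v L L' r).toNNReal) ∧
      -- explicit variance in a special case
      (v = BidAskSpread.Scheme.disjoint → ∀ m : ℕ, 2 ≤ m → L' + 1 = m * (L + 1) →
        BidAskSpread.asympVar σ S τ v L L' r =
          BidAskSpread.explicitVar (BidAskSpread.logPrice S pStar X) μ S τ L L') := by
  obtain ⟨r, hr⟩ := hModel.exists_tendsto_corr_empVar hσ hτ v hL hL'
  refine ⟨fun n hn hn' => ⟨hModel.integrable_spreadEstimator hσ hτ v hL hL' n,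
      hModel.integral_spreadEstimator hσ hτ v hL hL' hLL' hn hn'⟩,
    hModel.tendstoInMeasure_spreadEstimator hσ hτ v hL hL' hLL', ?_,
    r, hr, hModel.asympVar_nonneg hσ hτ hL hL' hr,
    hModel.tendstoInDistribution_spreadEstimator hσ hτ hL hL' hLL' hr, ?_⟩
  · rintro rfl
    exact hModel.ae_tendsto_spreadEstimator_disjoint hσ hτ hL hL' hLL'
  · rintro rfl m hm hLm
    exact hModel.asympVar_eq_explicitVar hσ hτ hL hL' hm hLm hr
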